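/- Let $K$ be a field of characteristic zero or $K=\mathbb{Z}$, and let $n,m\ge 0$. Let $\mathcal F$ be a field of rational functions in $n+m$ variables over the fraction field of $K$. A seed in $\mathcal F$ is a triple $(\mathbf x,\mathbf y,B)$, where $\mathbf x=(x_1,\dots,x_n)$ (exchangeable variables) and $\mathbf y=(x_{n+1},\dots,x_{n+m})$ (frozen variables) consist of $n+m$ elements of $\mathcal F$ that are algebraically independent over $K$ and together with $K$ generate $\mathcal F$ as a field, and $B=(b_{ij})$ is an $(n+m)\times n$ integer matrix whose upper $n\times n$ part is skew-symmetrizable, i.e. there are positive integers $d_1,\dots,d_n$ with $d_ib_{ij}=-d_jb_{ji}$ for $1\le i,j\le n$. The mutation of the seed in direction $i\in\{1,\dots,n\}$ is the seed obtained by replacing $x_i$ by $x_i'=x_i^{-1}\bigl(\prod_{b_{ki}>0}x_k^{b_{ki}}+\prod_{b_{ki}<0}x_k^{-b_{ki}}\bigr)$, keeping the other variables, and replacing $B$ by the matrix with entries $-b_{jk}$ if $j=i$ or $k=i$, and $b_{jk}+\frac12(|b_{ji}|b_{ik}+b_{ji}|b_{ik}|)$ otherwise. Two seeds are mutation-equivalent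 if one arises from the other by a finite sequence of mutations. For a seed with exchangeable variables $\mathbf z=(z_1,\dots,z_n)$ and frozen variables $\mathbf y$, let $\mathcal L_{\mathbf z}=K[u^{\pm1}\mid u\in\mathbf z\cup\mathbf y]\subseteq\mathcal F$; write $\mathbf z_0=\mathbf z$, and for $1\le i\le n$ let $\mathbf z_i$ be the exchangeable variables of its mutation in direction $i$. The upper cluster algebra of a seed $\Sigma=(\mathbf x,\mathbf y,B)$ is $\mathcal U=\mathcal U(\Sigma)=\bigcap_{\mathbf z}\mathcal L_{\mathbf z}$, the intersection over all seeds $(\mathbf z,\mathbf y,C)$ mutation-equivalent to $\Sigma$. For a domain $A$, let $\mathfrak X(A)$ be the set of its prime ideals of height $1$. The domain $A$ is a Krull domain if $A_{\mathfrak p}$ is a discrete valuation ring for every $\mathfrak p\in\mathfrak X(A)$, $A=\bigcap_{\mathfrak p\in\mathfrak X(A)}A_{\mathfrak p}$ inside the quotient field of $A$, and every nonzero element of $A$ lies in only finitely many $\mathfrak p\in\mathfrak X(A)$. **Theorem.** Let $\Sigma=(\mathbf x,\mathbf y,B)$ be a seed in $\mathcal F$ and suppose that $\mathcal U=\mathcal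 U(\Sigma)$ is a Krull domain. 1. For every $\mathfrak p\in\mathfrak X(\mathcal U)$ there is a seed $(\mathbf z,\mathbf y,C)$ mutation-equivalent to $\Sigma$ such that $\mathfrak p\mathcal L_{\mathbf z}\in\mathfrak X(\mathcal L_{\mathbf z})$. 2. If $(\mathbf z,\mathbf y,C)$ is any seed in $\mathcal F$ with the same frozen variables $\mathbf y$ (mutation-equivalent to $\Sigma$ or not) such that $\mathcal U=\bigcap_{i=0}^n\mathcal L_{\mathbf z_i}$, then for every $\mathfrak p\in\mathfrak X(\mathcal U)$ there is $k\in\{0,\dots,n\}$ such that $\mathfrak p\mathcal L_{\mathbf z_k}\in\mathfrak X(\mathcal L_{\mathbf z_k})$. -/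

import Mathlib

/-! ### Krull domains -/

/-- The set of height-one prime ideals of a commutative ring. -/
def heightOnePrimes (A : Type*) [CommRing A] : Set (Ideal A) :=
  {p | p.IsPrime ∧ p.height = 1}

/-- Krull domains: all localizations at height-one primes are discrete valuation rings, the domain
is the intersection of these localizations inside its field of fractions, and every nonzero element
lies in only finitely many height-one primes. -/
structure IsKrullDomain (A : Type*) [CommRing A] [IsDomain A] : Prop where
  isDiscreteValuationRing : ∀ (p : Ideal A) [p.IsPrime], p ∈ heightOnePrimes A →
    IsDiscreteValuationRing (Localization.AtPrime p)
  iInter_localization : ∀ x : FractionRing A,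
    (∀ p ∈ heightOnePrimes A, ∃ a s : A, s ∉ p ∧
      x = algebraMap A (FractionRing A) a / algebraMap A (FractionRing A) s) →
    ∃ a : A, x = algebraMap A (FractionRing A) a
  finite_heightOnePrimes : ∀ a : A, a ≠ 0 → {p ∈ heightOnePrimes A | a ∈ p}.Finite

/-! ### Seeds and mutation -/

/-- A seed with ambient field `F` over the base ring `K`, with `n` exchangeable variables (indexed
by `Sum.inl`) and `m` frozen variables (indexed by `Sum.inr`). -/
structure Seed (K F : Type*) [CommRing K] [Field F] [Algebra K F] (n m : ℕ) where
  /-- the exchangeable variables followed by the frozen variables -/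
  var : Fin n ⊕ Fin m → F
  /-- the extended exchange matrix -/
  B : Matrix (Fin n ⊕ Fin m) (Fin n) ℤ
  algebraicIndependent : AlgebraicIndependent K var
  /-- `F` is the field of rational functions in the variables over the fraction field of `K` -/
  generates : Subfield.closure (Set.range (algebraMap K F) ∪ Set.range var) = ⊤
  skewSymmetrizable : ∃ d : Fin n → ℤ, (∀ i, 0 < d i) ∧
    ∀ i j, d i * B (Sum.inl i) j = -(d j * B (Sum.inl j) i)

namespace Seed

/-- Mutation of extended exchange matrices (the division by `2` is exact). -/
def mutateMatrix {n m : ℕ} (B : Matrix (Fin n ⊕ Fin m) (Fin n) ℤ) (i : Fin n) :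
    Matrix (Fin n ⊕ Fin m) (Fin n) ℤ :=
  fun j k =>
    if j = Sum.inl i ∨ k = i then -B j k
    else B j k + (|B j i| * B (Sum.inl i) k + B j i * |B (Sum.inl i) k|) / 2

theorem two_dvd_mutation (a b : ℤ) : 2 ∣ |a| * b + a * |b| := by
  rcases abs_choice a with ha | ha <;> rcases abs_choice b with hb | hb <;> rw [ha, hb]
  · exact ⟨a * b, by ring⟩
  · exact ⟨0, by ring⟩
  · exact ⟨0, by ring⟩
  · exact ⟨-(a * b), by ring⟩

theorem mutateMatrix_skew {n m : ℕ} (B : Matrix (Fin n ⊕ Fin m) (Fin n) ℤ) (k : Fin n)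
    (d : Fin n → ℤ) (hd : ∀ i, 0 < d i)
    (h : ∀ i j, d i * B (Sum.inl i) j = -(d j * B (Sum.inl j) i)) (i j : Fin n) :
    d i * mutateMatrix B k (Sum.inl i) j = -(d j * mutateMatrix B k (Sum.inl j) i) := by
  have habs : ∀ i j, d i * |B (Sum.inl i) j| = d j * |B (Sum.inl j) i| := fun i j => by
    have := congrArg abs (h i j)
    rwa [abs_neg, abs_mul, abs_mul, abs_of_pos (hd i), abs_of_pos (hd j)] at this
  unfold mutateMatrix
  by_cases hi : i = k
  · subst hi; simp [h i j]
  by_cases hj : j = k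
  · subst hj; simp [h i j]
  simp only [Sum.inl.injEq, hi, hj, or_self, if_false]
  obtain ⟨u, hu⟩ := two_dvd_mutation (B (Sum.inl i) k) (B (Sum.inl k) j)
  obtain ⟨v, hv⟩ := two_dvd_mutation (B (Sum.inl j) k) (B (Sum.inl k) i)
  rw [hu, hv, Int.mul_ediv_cancel_left _ two_ne_zero, Int.mul_ediv_cancel_left _ two_ne_zero]
  have key : d i * (2 * u) = -(d j * (2 * v)) := by
    rw [← hu, ← hv]
    linear_combination B (Sum.inl k) j * habs i k + |B (Sum.inl k) j| * h i k
      + |B (Sum.inl k) i| * h k j - B (Sum.inl k) i * habs k j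
  linarith [h i j]

variable {K F : Type*} [CommRing K] [Field F] [Algebra K F] {n m : ℕ}

theorem B_diag (S : Seed K F n m) (i : Fin n) : S.B (Sum.inl i) i = 0 := by
  obtain ⟨d, hd, h⟩ := S.skewSymmetrizable
  have h1 := h i i
  have h2 : d i * S.B (Sum.inl i) i = 0 := by linarith
  exact (mul_eq_zero.mp h2).resolve_left (hd i).ne'

/-- The exchange polynomial `x_i x_i'`, evaluated in the ambient field. The exponents `b.toNat` and
`(-b).toNat` are the positive and negative parts of `b`. -/
noncomputable def exchange (S : Seed K F n m) (i : Fin n) : F :=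
  ∏ k, S.var k ^ (S.B k i).toNat + ∏ k, S.var k ^ (-S.B k i).toNat

/-- The variables of the mutation in direction `i`. -/
noncomputable def mutateVar (S : Seed K F n m) (i : Fin n) : Fin n ⊕ Fin m → F :=
  Function.update S.var (Sum.inl i) ((S.var (Sum.inl i))⁻¹ * S.exchange i)

theorem exchange_ne_zero [CharZero K] (S : Seed K F n m) (i : Fin n) : S.exchange i ≠ 0 := by
  let f : MvPolynomial (Fin n ⊕ Fin m) K :=
    ∏ k, MvPolynomial.X k ^ (S.B k i).toNat + ∏ k, MvPolynomial.X k ^ (-S.B k i).toNat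
  have hf : MvPolynomial.aeval S.var f = S.exchange i := by
    simp [f, exchange]
  have hf0 : f ≠ 0 := fun h => by
    have h1 : MvPolynomial.eval (fun _ => (1 : K)) f = 1 + 1 := by simp [f]
    rw [h, map_zero, one_add_one_eq_two] at h1
    exact two_ne_zero h1.symm
  rw [← hf]
  exact fun h => hf0 ((injective_iff_map_eq_zero _).mp S.algebraicIndependent f h)

theorem exchange_mem_of {R : Type*} [SetLike R F] [SubsemiringClass R F] (S : Seed K F n m)
    (i : Fin n) (A : R) (hA : ∀ k, k ≠ Sum.inl i → S.var k ∈ A) : S.exchange i ∈ A := by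
  have hmem : ∀ e : Fin n ⊕ Fin m → ℕ, e (Sum.inl i) = 0 → ∏ k, S.var k ^ e k ∈ A := by
    refine fun e he => prod_mem fun k _ => ?_
    by_cases hk : k = Sum.inl i
    · rw [hk, he, pow_zero]; exact one_mem A
    · exact pow_mem (hA k hk) _
  exact add_mem (hmem _ (by simp [B_diag])) (hmem _ (by simp [B_diag]))

theorem mutateVar_algebraicIndependent [CharZero K] (S : Seed K F n m) (i : Fin n) :
    AlgebraicIndependent K (S.mutateVar i) := by
  have hne : ∀ k, k ≠ Sum.inl i → S.mutateVar i k = S.var k := fun k hk => by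
    simp [mutateVar, hk]
  have himg : S.mutateVar i '' {Sum.inl i}ᶜ = S.var '' {Sum.inl i}ᶜ :=
    Set.image_congr fun k hk => hne k hk
  have hS := (AlgebraicIndependent.iff_transcendental_adjoin_image (Sum.inl i)).mp
    S.algebraicIndependent
  refine (AlgebraicIndependent.iff_transcendental_adjoin_image (Sum.inl i)).mpr ⟨?_, ?_⟩
  · have : (fun j : {j // j ≠ Sum.inl i} => S.mutateVar i j) =
        fun j : {j // j ≠ Sum.inl i} => S.var j :=
      funext fun j => hne j.1 j.2
    rw [this]; exact hS.1
  · rw [himg]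
    intro halg
    apply hS.2
    have hM : IsAlgebraic (Algebra.adjoin K (S.var '' {Sum.inl i}ᶜ)) (S.exchange i) :=
      isAlgebraic_algebraMap (⟨S.exchange i, S.exchange_mem_of i _ fun k hk =>
        Algebra.subset_adjoin ⟨k, hk, rfl⟩⟩ : Algebra.adjoin K (S.var '' {Sum.inl i}ᶜ))
    have hx : S.var (Sum.inl i) = (S.mutateVar i (Sum.inl i))⁻¹ * S.exchange i := by
      have := S.exchange_ne_zero i
      simp only [mutateVar, Function.update_self]
      field_simp
    rw [hx]
    exact halg.inv.mul hM

theorem mutateVar_generates [CharZero K] (S : Seed K F n m) (i : Fin n) :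
    Subfield.closure (Set.range (algebraMap K F) ∪ Set.range (S.mutateVar i)) = ⊤ := by
  have hne : ∀ k, k ≠ Sum.inl i → S.mutateVar i k = S.var k := fun k hk => by
    simp [mutateVar, hk]
  rw [eq_top_iff, ← S.generates, Subfield.closure_le]
  set A := Subfield.closure (Set.range (algebraMap K F) ∪ Set.range (S.mutateVar i)) with hA
  have hmem : ∀ k, S.mutateVar i k ∈ A := fun k => Subfield.subset_closure (Or.inr ⟨k, rfl⟩)
  have hvar : ∀ k, k ≠ Sum.inl i → S.var k ∈ A := fun k hk => hne k hk ▸ hmem k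
  rintro _ (⟨a, rfl⟩ | ⟨k, rfl⟩)
  · exact Subfield.subset_closure (Or.inl ⟨a, rfl⟩)
  · by_cases hk : k = Sum.inl i
    · have hx : S.var k = (S.mutateVar i (Sum.inl i))⁻¹ * S.exchange i := by
        have := S.exchange_ne_zero i
        simp only [mutateVar, Function.update_self, hk]
        field_simp
      rw [hx]
      exact mul_mem (inv_mem (hmem _)) (S.exchange_mem_of i A hvar)
    · exact hvar k hk

/-- Mutation of a seed in direction `i`. -/
noncomputable def mutate [CharZero K] (S : Seed K F n m) (i : Fin n) : Seed K F n m where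
  var := S.mutateVar i
  B := mutateMatrix S.B i
  algebraicIndependent := S.mutateVar_algebraicIndependent i
  generates := S.mutateVar_generates i
  skewSymmetrizable := by
    obtain ⟨d, hd, h⟩ := S.skewSymmetrizable
    exact ⟨d, hd, mutateMatrix_skew S.B i d hd h⟩

/-- `T` is obtained from `S` by a finite sequence of mutations. -/
def MutationEquivalent [CharZero K] (S T : Seed K F n m) : Prop :=
  Relation.ReflTransGen (fun P Q : Seed K F n m => ∃ i : Fin n, Q = P.mutate i) S T

/-- For `k = none` the seed itself, and for `k = some i` its mutation in direction `i`. -/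
noncomputable def neighbor [CharZero K] (S : Seed K F n m) : Option (Fin n) → Seed K F n m
  | none => S
  | some i => S.mutate i

/-! ### Laurent polynomial rings and upper cluster algebras -/

/-- The ring of Laurent polynomials over `K` in all the variables of a seed. -/
def laurent (S : Seed K F n m) : Subalgebra K F :=
  Algebra.adjoin K (Set.range S.var ∪ Set.range fun k => (S.var k)⁻¹)

/-- The upper cluster algebra of a seed. -/
def upperClusterAlgebra [CharZero K] (S : Seed K F n m) : Subalgebra K F :=
  ⨅ (T : Seed K F n m) (_ : S.MutationEquivalent T), T.laurent

end Seed

/-!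
For a family of localizations `L_t = U[1/f_t]` of a Krull domain `U` with `U = ⋂ L_t`, every
height-one prime `p` of `U` avoids some `f_t`, so that it stays a height-one prime in `L_t`.
Otherwise `p` contains all the `f_t`; but the quotient field of `U` has an element `g` with a simple
pole at `p` and no other pole (`IsKrullDomain.exists_simple_pole`), and then every `f_t * g` lies in
`U`, so `g` lies in every `L_t`, hence in `U`, which is absurd
(`IsKrullDomain.exists_map_mem_heightOnePrimes`).

To apply this, the Laurent polynomial rings in question have to be localizations of the upper
cluster algebra at the product of their variables, that is, the variables of the seeds have to lie
in the upper cluster algebra. For the intersection of the rings of a seed and its neighbors this is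
read off the exchange relations (`Seed.neighbor_var_mem`). For the intersection over all
mutation-equivalent seeds it is the Laurent phenomenon (`Seed.MutationEquivalent.var_mem_laurent`),
which is proved in two steps.

If the columns of the exchange matrix are linearly independent, the upper bound of a seed (the
intersection of the Laurent polynomial rings of the seed and its neighbors) does not grow under
mutation (`Seed.mem_neighbor_mutate`). Indeed, let `f` lie in the upper bound of `S`, and let `L` be
the Laurent polynomial ring after mutation in directions `i` and `j`. Then `f` lies in `L[1/x_j]`
because it is a Laurent polynomial after mutation in direction `i`, and in `L[1/x_i]` because it is
a polynomial in `x_j`, `x_j'` and the other variables and their inverses, where `x_j'` lies in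
`L[1/x_i]` (`Seed.mutateVar_mem_away`). Since `x_i` and `x_j` are coprime in `L`
(`Seed.div_var_mem_mutate_mutate`), `f` lies in `L`. Independence of the columns enters when
`b_ij = 0`: the two exchange polynomials are then coprime (`Seed.binomial_dvd_of_dvd_mul`).

For an arbitrary seed, an identity matrix is appended to the exchange matrix, which makes the
columns independent, and the frozen variables that this adds are specialized at `1`
(`Seed.exists_specialization`).
-/

/-! ### Height-one primes of Krull domains -/

/-- A uniformizer of the localization at `p`, with its defining property cleared of denominators. -/
theorem exists_uniformizer_of_isDiscreteValuationRing {A : Type*} [CommRing A] [IsDomain A]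
    (p : Ideal A) [p.IsPrime] [IsDiscreteValuationRing (Localization.AtPrime p)] :
    ∃ a ∈ p, a ≠ 0 ∧ ∀ f ∈ p, ∃ c s : A, s ∉ p ∧ s * f = a * c := by
  obtain ⟨ϖ, hϖ⟩ := IsDiscreteValuationRing.exists_irreducible (Localization.AtPrime p)
  have hmax := hϖ.maximalIdeal_eq
  obtain ⟨⟨a, s⟩, has⟩ := IsLocalization.surj p.primeCompl ϖ
  have hinj : Function.Injective (algebraMap A (Localization.AtPrime p)) :=
    IsLocalization.injective _ p.primeCompl_le_nonZeroDivisors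
  have hmem (f : A) : algebraMap A (Localization.AtPrime p) f ∈ Ideal.span {ϖ} ↔ f ∈ p := by
    rw [← hmax, IsLocalization.AtPrime.to_map_mem_maximal_iff (Localization.AtPrime p) p]
  have hs : IsUnit (algebraMap A (Localization.AtPrime p) s) :=
    IsLocalization.map_units _ s
  refine ⟨a, (hmem a).1 ?_, ?_, fun f hf => ?_⟩
  · rw [← has]
    exact Ideal.mul_mem_right _ _ (Ideal.mem_span_singleton_self ϖ)
  · rintro rfl
    rw [map_zero] at has
    exact (mul_ne_zero hϖ.ne_zero hs.ne_zero) has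
  · obtain ⟨y, hy⟩ := Ideal.mem_span_singleton.1 ((hmem f).2 hf)
    obtain ⟨⟨c, t⟩, hct⟩ := IsLocalization.surj p.primeCompl y
    refine ⟨c, s * t, ?_, hinj ?_⟩
    · exact p.primeCompl.mul_mem s.2 t.2
    · simp only [map_mul] at has hct ⊢
      rw [hy, ← has, ← hct]
      ring

theorem exists_pow_mul_eq_of_isDiscreteValuationRing {A : Type*} [CommRing A] [IsDomain A]
    (q : Ideal A) [q.IsPrime] [IsDiscreteValuationRing (Localization.AtPrime q)] {a b : A}
    (ha : a ≠ 0) (hb : b ∈ q) : ∃ (N : ℕ) (c s : A), s ∉ q ∧ s * b ^ N = a * c := by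
  obtain ⟨ϖ, hϖ⟩ := IsDiscreteValuationRing.exists_irreducible (Localization.AtPrime q)
  have hinj : Function.Injective (algebraMap A (Localization.AtPrime q)) :=
    IsLocalization.injective _ q.primeCompl_le_nonZeroDivisors
  obtain ⟨N, u, hu⟩ := IsDiscreteValuationRing.eq_unit_mul_pow_irreducible
    ((map_ne_zero_iff _ hinj).2 ha) hϖ
  have hbϖ : ϖ ∣ algebraMap A (Localization.AtPrime q) b := by
    rw [← Ideal.mem_span_singleton, ← hϖ.maximalIdeal_eq,
      IsLocalization.AtPrime.to_map_mem_maximal_iff (Localization.AtPrime q) q]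
    exact hb
  obtain ⟨y, hy⟩ := pow_dvd_pow_of_dvd hbϖ N
  obtain ⟨⟨c, t⟩, hct⟩ := IsLocalization.surj q.primeCompl ((↑u⁻¹ : Localization.AtPrime q) * y)
  refine ⟨N, c, t, t.2, hinj ?_⟩
  simp only [map_mul, map_pow] at hct ⊢
  rw [hy, hu, ← hct]
  linear_combination (-(ϖ ^ N * y * algebraMap A (Localization.AtPrime q) t)) * u.mul_inv

/-- In a Krull domain, a height-one prime `p` carries an element `b / a` of the quotient field with
a simple pole at `p` and no other pole. -/
theorem IsKrullDomain.exists_simple_pole {A : Type*} [CommRing A] [IsDomain A]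
    (hA : IsKrullDomain A) {p : Ideal A} (hp : p ∈ heightOnePrimes A) :
    ∃ a ∈ p, ∃ b ∉ p, a ≠ 0 ∧ ∀ f ∈ p, a ∣ f * b := by
  classical
  have := hp.1
  have := hA.isDiscreteValuationRing p hp
  obtain ⟨a, hap, ha0, hunif⟩ := exists_uniformizer_of_isDiscreteValuationRing p
  have hfin := (hA.finite_heightOnePrimes a ha0).subset
    (Set.sdiff_subset (t := {p}))
  have hq : ∀ q ∈ hfin.toFinset, ∃ b ∈ q, b ∉ p ∧ ∃ (N : ℕ) (c s : A), s ∉ q ∧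
      s * b ^ N = a * c := by
    intro q hq
    obtain ⟨⟨hq1, -⟩, hne⟩ := hfin.mem_toFinset.1 hq
    have := hq1.1
    have := hA.isDiscreteValuationRing q hq1
    have hle : ¬ q ≤ p := by
      intro hle
      have : q.FiniteHeight := ⟨Or.inr (by rw [hq1.2]; exact ENat.one_ne_top)⟩
      exact hne (Ideal.eq_of_le_of_height_le q hle (by rw [hp.2, hq1.2]))
    obtain ⟨b, hbq, hbp⟩ := SetLike.not_le_iff_exists.1 hle
    exact ⟨b, hbq, hbp, exists_pow_mul_eq_of_isDiscreteValuationRing q ha0 hbq⟩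
  choose! β hβq hβp N c s hs hβ using hq
  refine ⟨a, hap, ∏ q ∈ hfin.toFinset, β q ^ N q, ?_, ha0, fun f hf => ?_⟩
  · rw [Ideal.IsPrime.prod_mem_iff]
    rintro ⟨q, hq, hmem⟩
    exact hβp q hq (Ideal.IsPrime.mem_of_pow_mem ‹_› _ hmem)
  · set b := ∏ q ∈ hfin.toFinset, β q ^ N q with hb
    have hinj : Function.Injective (algebraMap A (FractionRing A)) :=
      IsFractionRing.injective A (FractionRing A)
    have hne : ∀ x : A, x ≠ 0 → algebraMap A (FractionRing A) x ≠ 0 := fun x hx =>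
      (map_ne_zero_iff _ hinj).2 hx
    obtain ⟨e, he⟩ := hA.iInter_localization
      (algebraMap A _ (f * b) / algebraMap A _ a) (by
        intro q hq
        have key : ∃ d t : A, t ∉ q ∧ t * (f * b) = a * d := by
          by_cases hqp : q = p
          · subst hqp
            obtain ⟨d, t, ht, h⟩ := hunif f hf
            exact ⟨d * b, t, ht, by linear_combination b * h⟩
          by_cases haq : a ∈ q
          · have hmem : q ∈ hfin.toFinset := hfin.mem_toFinset.2 ⟨⟨hq, haq⟩, hqp⟩
            refine ⟨f * c q * ∏ r ∈ hfin.toFinset.erase q, β r ^ N r, s q, hs q hmem, ?_⟩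
            rw [hb, ← Finset.mul_prod_erase _ _ hmem]
            linear_combination (f * ∏ r ∈ hfin.toFinset.erase q, β r ^ N r) * hβ q hmem
          · exact ⟨f * b, a, haq, rfl⟩
        obtain ⟨d, t, ht, h⟩ := key
        refine ⟨d, t, ht, ?_⟩
        have ht0 : t ≠ 0 := fun h0 => ht (h0 ▸ q.zero_mem)
        rw [div_eq_div_iff (hne a ha0) (hne t ht0), ← map_mul, ← map_mul, mul_comm _ t, h,
          mul_comm])
    refine ⟨e, hinj ?_⟩
    rw [map_mul _ a e, ← he, mul_div_cancel₀ _ (hne a ha0)]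

/-! ### Localizations inside a field -/

section Away

variable {K F : Type*} [CommRing K] [Field F] [Algebra K F]

/-- The localization `A[1/x]` of a subalgebra `A` of a field at one of its elements, as a
subalgebra of the field (the whole field when `x = 0`). -/
def Subalgebra.away (A : Subalgebra K F) (x : A) : Subalgebra K F where
  carrier := {f | ∃ N : ℕ, (x : F) ^ N * f ∈ A}
  mul_mem' := by
    rintro f g ⟨N, hf⟩ ⟨M, hg⟩
    exact ⟨N + M, by convert A.mul_mem hf hg using 1; ring⟩
  add_mem' := by
    rintro f g ⟨N, hf⟩ ⟨M, hg⟩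
    refine ⟨N + M, ?_⟩
    convert A.add_mem (A.mul_mem (A.pow_mem x.2 M) hf) (A.mul_mem (A.pow_mem x.2 N) hg) using 1
    ring
  algebraMap_mem' r := ⟨0, by simp⟩

theorem Subalgebra.mem_away {A : Subalgebra K F} {x : A} {f : F} :
    f ∈ A.away x ↔ ∃ N : ℕ, (x : F) ^ N * f ∈ A := Iff.rfl

theorem Subalgebra.le_away (A : Subalgebra K F) (x : A) : A ≤ A.away x :=
  fun f hf => ⟨0, by simpa using hf⟩

theorem Subalgebra.inv_mem_away (A : Subalgebra K F) (x : A) : (x : F)⁻¹ ∈ A.away x := by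
  refine ⟨1, ?_⟩
  by_cases h : (x : F) = 0
  · simp [h]
  · simp [h]

theorem Subalgebra.isLocalizationAway {A L : Subalgebra K F} (h : A ≤ L) (x : A)
    (hx : (x : F) ≠ 0) (hinv : (x : F)⁻¹ ∈ L) (hL : L ≤ A.away x) :
    letI := (Subalgebra.inclusion h).toRingHom.toAlgebra
    IsLocalization.Away x L := by
  let := (Subalgebra.inclusion h).toRingHom.toAlgebra
  refine IsLocalization.Away.mk x ?_ (fun s => ?_) fun a b hab =>
    ⟨0, by rw [Subalgebra.inclusion_injective h hab]⟩
  · exact IsUnit.of_mul_eq_one (⟨_, hinv⟩ : L) (Subtype.ext (mul_inv_cancel₀ hx))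
  · obtain ⟨N, hN⟩ := hL s.2
    exact ⟨N, ⟨_, hN⟩, Subtype.ext (mul_comm _ _)⟩

/-- If a Krull domain `A` inside a field is the intersection of localizations `A[1/f t]`, then every
height-one prime of `A` survives in one of them: otherwise it contains all the `f t`, and an element
with a simple pole at that prime and no other pole lies in the intersection. -/
theorem IsKrullDomain.exists_map_mem_heightOnePrimes {A : Subalgebra K F} (hA : IsKrullDomain A)
    {ι : Type*} (L : ι → Subalgebra K F) (f : ι → A) (hle : ∀ t, A ≤ L t)
    (hf : ∀ t, (f t : F) ≠ 0) (hinv : ∀ t, (f t : F)⁻¹ ∈ L t) (hL : ∀ t, L t ≤ A.away (f t))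
    (hinter : ∀ x : F, (∀ t, x ∈ L t) → x ∈ A) {p : Ideal A} (hp : p ∈ heightOnePrimes A) :
    ∃ t, p.map (Subalgebra.inclusion (hle t)) ∈ heightOnePrimes (L t) := by
  have := hp.1
  obtain ⟨t, ht⟩ : ∃ t, f t ∉ p := by
    by_contra! hall
    obtain ⟨a, hap, b, hbp, ha0, hdvd⟩ := hA.exists_simple_pole hp
    have ha0' : (a : F) ≠ 0 := fun h => ha0 (Subtype.ext h)
    have hmem : (b : F) / a ∈ A := hinter _ fun t => by
      obtain ⟨c, hc⟩ := hdvd (f t) (hall t)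
      have hc' : (f t : F) * b = a * c := congrArg Subtype.val hc
      have : (b : F) / a = c * (f t : F)⁻¹ := by
        have := hf t
        field_simp
        linear_combination hc'
      rw [this]
      exact mul_mem (hle t c.2) (hinv t)
    refine hbp ?_
    have : b = a * ⟨_, hmem⟩ := Subtype.ext (by simp [mul_div_cancel₀ _ ha0'])
    rw [this]
    exact p.mul_mem_right _ hap
  refine ⟨t, ?_⟩
  let := (Subalgebra.inclusion (hle t)).toRingHom.toAlgebra
  have : IsLocalization.Away (f t) (L t) :=
    Subalgebra.isLocalizationAway (hle t) (f t) (hf t) (hinv t) (hL t)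
  have hdisj : Disjoint (Submonoid.powers (f t) : Set A) p := by
    rw [Ideal.disjoint_powers_iff_notMem _ hp.1.isRadical]
    exact ht
  have hmap : p.map (Subalgebra.inclusion (hle t)) = p.map (algebraMap A (L t)) := rfl
  rw [hmap]
  exact ⟨IsLocalization.isPrime_of_isPrime_disjoint (Submonoid.powers (f t)) _ p hp.1 hdisj,
    (IsLocalization.height_map_of_disjoint (Submonoid.powers (f t)) p hdisj).trans hp.2⟩

end Away

/-! ### Laurent polynomial rings of seeds -/

theorem Subalgebra.zpow_mem {K F : Type*} [CommRing K] [Field F] [Algebra K F]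
    (A : Subalgebra K F) {x : F} (hx : x ∈ A) (hinv : x⁻¹ ∈ A) (e : ℤ) : x ^ e ∈ A := by
  cases e with
  | ofNat N => simpa using A.pow_mem hx N
  | negSucc N => simpa [zpow_negSucc] using A.pow_mem hinv (N + 1)

namespace Seed

variable {K F : Type*} [CommRing K] [Field F] [Algebra K F] {n m : ℕ}

theorem var_mem_laurent (S : Seed K F n m) (k : Fin n ⊕ Fin m) : S.var k ∈ S.laurent :=
  Algebra.subset_adjoin (Or.inl ⟨k, rfl⟩)

theorem inv_var_mem_laurent (S : Seed K F n m) (k : Fin n ⊕ Fin m) : (S.var k)⁻¹ ∈ S.laurent :=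
  Algebra.subset_adjoin (Or.inr ⟨k, rfl⟩)

theorem var_ne_zero (S : Seed K F n m) (k : Fin n ⊕ Fin m) : S.var k ≠ 0 := by
  have : Nontrivial K := (algebraMap K F).domain_nontrivial
  exact S.algebraicIndependent.ne_zero k

theorem laurent_le {S : Seed K F n m} {A : Subalgebra K F}
    (h : ∀ k, S.var k ∈ A) (h' : ∀ k, (S.var k)⁻¹ ∈ A) : S.laurent ≤ A := by
  refine Algebra.adjoin_le ?_
  rintro _ (⟨k, rfl⟩ | ⟨k, rfl⟩)
  exacts [h k, h' k]

theorem prod_var_ne_zero (S : Seed K F n m) : ∏ k, S.var k ≠ 0 :=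
  Finset.prod_ne_zero_iff.2 fun k _ => S.var_ne_zero k

theorem inv_prod_var_mem_laurent (S : Seed K F n m) : (∏ k, S.var k)⁻¹ ∈ S.laurent := by
  rw [← Finset.prod_inv_distrib]
  exact prod_mem fun k _ => S.inv_var_mem_laurent k

/-- A subalgebra containing the variables of a seed yields the Laurent polynomial ring upon
inverting the product of the variables. -/
theorem laurent_le_away (S : Seed K F n m) (A : Subalgebra K F) (h : ∀ k, S.var k ∈ A) :
    S.laurent ≤ A.away ⟨∏ k, S.var k, prod_mem fun k _ => h k⟩ := by
  classical
  refine laurent_le (fun k => A.le_away _ (h k)) fun k => Subalgebra.mem_away.2 ⟨1, ?_⟩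
  have : (∏ k, S.var k) ^ 1 * (S.var k)⁻¹ = ∏ l ∈ Finset.univ.erase k, S.var l := by
    rw [pow_one, ← Finset.mul_prod_erase _ _ (Finset.mem_univ k), mul_comm (S.var k), mul_assoc,
      mul_inv_cancel₀ (S.var_ne_zero k), mul_one]
  rw [this]
  exact prod_mem fun l _ => h l

/-- The universal property of the Laurent polynomial ring of a seed: its variables can be sent to
arbitrary units. -/
theorem exists_algHom_laurent (S : Seed K F n m) {A : Type*} [CommRing A] [Algebra K A]
    (u : Fin n ⊕ Fin m → Aˣ) :
    ∃ φ : S.laurent →ₐ[K] A, ∀ k, φ ⟨S.var k, S.var_mem_laurent k⟩ = u k := by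
  let ι : MvPolynomial (Fin n ⊕ Fin m) K →ₐ[K] S.laurent :=
    MvPolynomial.aeval fun k => ⟨S.var k, S.var_mem_laurent k⟩
  have hval : ∀ p, (ι p : F) = MvPolynomial.aeval S.var p := fun p => by
    change S.laurent.val (ι p) = _
    rw [← AlgHom.comp_apply]
    congr 1
    ext k
    simp [ι]
  let P : MvPolynomial (Fin n ⊕ Fin m) K := ∏ k, MvPolynomial.X k
  have hP : (ι P : F) = ∏ k, S.var k := by simp [hval, P]
  let := ι.toRingHom.toAlgebra
  have hloc : IsLocalization.Away P S.laurent := by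
    refine IsLocalization.Away.mk P ?_ (fun s => ?_) fun a b hab => ⟨0, ?_⟩
    · refine IsUnit.of_mul_eq_one (⟨_, S.inv_prod_var_mem_laurent⟩ : S.laurent) (Subtype.ext ?_)
      change (ι P : F) * _ = 1
      rw [hP, mul_inv_cancel₀ S.prod_var_ne_zero]
    · obtain ⟨N, hN⟩ := S.laurent_le_away (MvPolynomial.aeval S.var).range
        (fun k => ⟨MvPolynomial.X k, by simp⟩) s.2
      obtain ⟨q, hq⟩ := hN
      refine ⟨N, q, Subtype.ext ?_⟩
      change (s : F) * (ι P : F) ^ N = ι q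
      rw [hP, hval, mul_comm]
      exact hq.symm
    · have : MvPolynomial.aeval S.var a = MvPolynomial.aeval S.var b := by
        rw [← hval, ← hval]
        exact congrArg Subtype.val hab
      rw [S.algebraicIndependent this]
  let ev : MvPolynomial (Fin n ⊕ Fin m) K →ₐ[K] A := MvPolynomial.aeval fun k => (u k : A)
  have hu : IsUnit (ev.toRingHom P) := by
    have : ev.toRingHom P = ↑(∏ k, u k) := by
      change ev P = _
      simp [ev, P, Units.coe_prod]
    rw [this]
    exact Units.isUnit _
  have hlift : ∀ q, IsLocalization.Away.lift P hu (ι q) = ev q := fun q =>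
    IsLocalization.Away.lift_eq P hu q
  refine ⟨{ IsLocalization.Away.lift P hu with commutes' := fun c => ?_ }, fun k => ?_⟩
  · change IsLocalization.Away.lift P hu (algebraMap K S.laurent c) = _
    rw [← ι.commutes c, hlift, ev.commutes]
  · have : (⟨S.var k, S.var_mem_laurent k⟩ : S.laurent) = ι (MvPolynomial.X k) := by simp [ι]
    change IsLocalization.Away.lift P hu _ = _
    rw [this, hlift]
    simp [ev]

/-- Two homomorphisms on a Laurent polynomial ring agree if they agree on the variables. -/
theorem algHom_laurent_ext {S : Seed K F n m} {A : Type*} [CommRing A] [Algebra K A]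
    {φ ψ : S.laurent →ₐ[K] A}
    (h : ∀ k, φ ⟨S.var k, S.var_mem_laurent k⟩ = ψ ⟨S.var k, S.var_mem_laurent k⟩) : φ = ψ := by
  refine AlgHom.ext fun x => ?_
  have hle : S.laurent ≤ (AlgHom.equalizer φ ψ).map S.laurent.val := by
    refine laurent_le (fun k => ⟨⟨_, S.var_mem_laurent k⟩, h k, rfl⟩)
      fun k => ⟨⟨_, S.inv_var_mem_laurent k⟩, ?_, rfl⟩
    have hmul : (⟨_, S.var_mem_laurent k⟩ * ⟨_, S.inv_var_mem_laurent k⟩ : S.laurent) = 1 :=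
      Subtype.ext (mul_inv_cancel₀ (S.var_ne_zero k))
    have h1 := (map_mul φ _ _).symm.trans ((congrArg φ hmul).trans (map_one φ))
    have h2 := (map_mul ψ _ _).symm.trans ((congrArg ψ hmul).trans (map_one ψ))
    rw [← h k] at h2
    exact (left_inv_eq_right_inv ((mul_comm _ _).trans h1) h2)
  obtain ⟨y, hy, hyx⟩ := hle x.2
  rw [← show y = x from Subtype.ext hyx]
  exact hy

/-! ### Exchange relations -/

theorem mutateVar_self (S : Seed K F n m) (i : Fin n) :
    S.mutateVar i (Sum.inl i) = (S.var (Sum.inl i))⁻¹ * S.exchange i := by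
  simp [mutateVar]

theorem mutateVar_of_ne (S : Seed K F n m) {i : Fin n} {k : Fin n ⊕ Fin m} (hk : k ≠ Sum.inl i) :
    S.mutateVar i k = S.var k := by
  simp [mutateVar, hk]

theorem var_mul_mutateVar (S : Seed K F n m) (i : Fin n) :
    S.var (Sum.inl i) * S.mutateVar i (Sum.inl i) = S.exchange i := by
  rw [mutateVar_self, mul_inv_cancel_left₀ (S.var_ne_zero _)]

theorem B_eq_zero_iff (S : Seed K F n m) (i j : Fin n) :
    S.B (Sum.inl i) j = 0 ↔ S.B (Sum.inl j) i = 0 := by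
  obtain ⟨d, hd, h⟩ := S.skewSymmetrizable
  have := h i j
  constructor <;> intro h0 <;> rw [h0] at this <;>
    simpa [(hd i).ne', (hd j).ne'] using this

theorem B_pos_iff (S : Seed K F n m) (i j : Fin n) :
    0 < S.B (Sum.inl i) j ↔ S.B (Sum.inl j) i < 0 := by
  obtain ⟨d, hd, h⟩ := S.skewSymmetrizable
  have := h i j
  have hi := hd i
  have hj := hd j
  constructor <;> intro h0 <;> by_contra! hc <;> nlinarith

section Mutation

variable [CharZero K]

@[simp] theorem mutate_var (S : Seed K F n m) (i : Fin n) : (S.mutate i).var = S.mutateVar i := rfl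

@[simp] theorem mutate_B (S : Seed K F n m) (i : Fin n) :
    (S.mutate i).B = mutateMatrix S.B i := rfl

theorem mutateVar_ne_zero (S : Seed K F n m) (i : Fin n) (k : Fin n ⊕ Fin m) :
    S.mutateVar i k ≠ 0 :=
  (S.mutate i).var_ne_zero k

theorem mutateMatrix_col {B : Matrix (Fin n ⊕ Fin m) (Fin n) ℤ} (i : Fin n) (k : Fin n ⊕ Fin m) :
    mutateMatrix B i k i = -B k i := by simp [mutateMatrix]

theorem mutateMatrix_row {B : Matrix (Fin n ⊕ Fin m) (Fin n) ℤ} (i j : Fin n) :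
    mutateMatrix B i (Sum.inl i) j = -B (Sum.inl i) j := by simp [mutateMatrix]

/-- Mutation of the exchange matrix without absolute values and division. -/
theorem mutateMatrix_of_ne {B : Matrix (Fin n ⊕ Fin m) (Fin n) ℤ} {i j : Fin n}
    {k : Fin n ⊕ Fin m} (hk : k ≠ Sum.inl i) (hj : j ≠ i) :
    mutateMatrix B i k j =
      B k j + B k i * max (B (Sum.inl i) j) 0 + max (-B k i) 0 * B (Sum.inl i) j := by
  have hor : ¬ (k = Sum.inl i ∨ j = i) := by simp [hk, hj]
  rw [mutateMatrix, if_neg hor, add_assoc]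
  congr 1
  refine Int.ediv_eq_of_eq_mul_left two_ne_zero ?_
  rcases le_total 0 (B k i) with h1 | h1 <;> rcases le_total 0 (B (Sum.inl i) j) with h2 | h2 <;>
    simp [h1, h2, abs_of_nonneg, abs_of_nonpos] <;> ring

theorem mutateMatrix_mutateMatrix (B : Matrix (Fin n ⊕ Fin m) (Fin n) ℤ) (i : Fin n) :
    mutateMatrix (mutateMatrix B i) i = B := by
  ext k j
  by_cases hor : k = Sum.inl i ∨ j = i
  · rw [mutateMatrix, if_pos hor, mutateMatrix, if_pos hor, neg_neg]
  rw [mutateMatrix, if_neg hor, mutateMatrix_col, mutateMatrix_row, mutateMatrix, if_neg hor]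
  obtain ⟨c, hc⟩ := two_dvd_mutation (B k i) (B (Sum.inl i) j)
  have hc' : |-B k i| * -B (Sum.inl i) j + -B k i * |-B (Sum.inl i) j| = 2 * -c := by
    rw [abs_neg, abs_neg]; linear_combination -hc
  rw [hc, hc', Int.mul_ediv_cancel_left _ two_ne_zero, Int.mul_ediv_cancel_left _ two_ne_zero]
  ring

theorem exchange_mutate_self (S : Seed K F n m) (i : Fin n) :
    (S.mutate i).exchange i = S.exchange i := by
  have h (k) : (S.mutate i).var k ^ (S.B k i).toNat = S.var k ^ (S.B k i).toNat := by
    by_cases hk : k = Sum.inl i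
    · subst hk; simp [B_diag]
    · simp [mutateVar_of_ne S hk]
  have h' (k) : (S.mutate i).var k ^ (-S.B k i).toNat = S.var k ^ (-S.B k i).toNat := by
    by_cases hk : k = Sum.inl i
    · subst hk; simp [B_diag]
    · simp [mutateVar_of_ne S hk]
  rw [exchange, exchange, add_comm]
  simp only [mutate_B, mutateMatrix_col, neg_neg, h, h']

theorem mutate_mutate (S : Seed K F n m) (i : Fin n) : (S.mutate i).mutate i = S := by
  have hvar : ((S.mutate i).mutate i).var = S.var := by
    funext k
    by_cases hk : k = Sum.inl i
    · subst hk
      rw [mutate_var, mutateVar_self, exchange_mutate_self, ← var_mul_mutateVar, mutate_var,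
        mul_comm, mul_assoc, mul_inv_cancel₀ (S.mutateVar_ne_zero i _), mul_one]
    · rw [mutate_var, mutateVar_of_ne _ hk, mutate_var, mutateVar_of_ne _ hk]
  have hB : ((S.mutate i).mutate i).B = S.B := mutateMatrix_mutateMatrix S.B i
  generalize (S.mutate i).mutate i = T at hvar hB
  cases S
  cases T
  simp_all

theorem MutationEquivalent.symm {S T : Seed K F n m} (h : S.MutationEquivalent T) :
    T.MutationEquivalent S := by
  induction h with
  | refl => exact .refl
  | tail _ hPQ ih =>
    obtain ⟨i, rfl⟩ := hPQ
    exact .head ⟨i, (mutate_mutate _ i).symm⟩ ih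

/-- The variables of a seed and of its neighbors lie in the Laurent polynomial rings of all its
neighbors. -/
theorem neighbor_var_mem (S : Seed K F n m) (k l : Option (Fin n)) (r : Fin n ⊕ Fin m) :
    (S.neighbor k).var r ∈ (S.neighbor l).laurent := by
  have hother : ∀ {j : Fin n} {r}, r ≠ Sum.inl j → S.var r ∈ (S.mutate j).laurent := by
    intro j r hr
    rw [← S.mutateVar_of_ne hr]
    exact (S.mutate j).var_mem_laurent r
  have hvar : ∀ r, S.var r ∈ (S.neighbor l).laurent := by
    intro r
    cases l with
    | none => exact S.var_mem_laurent r
    | some j =>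
      by_cases hr : r = Sum.inl j
      · subst hr
        have : S.var (Sum.inl j) = (S.mutateVar j (Sum.inl j))⁻¹ * S.exchange j := by
          rw [← var_mul_mutateVar, mul_comm, mul_assoc,
            mul_inv_cancel₀ (S.mutateVar_ne_zero j _), mul_one]
        rw [this]
        exact mul_mem ((S.mutate j).inv_var_mem_laurent _)
          (S.exchange_mem_of j _ fun k hk => hother hk)
      · exact hother hr
  cases k with
  | none => exact hvar r
  | some i =>
    change S.mutateVar i r ∈ _
    by_cases hr : r = Sum.inl i
    · subst hr
      by_cases hl : l = some i
      · subst hl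
        exact (S.mutate i).var_mem_laurent _
      rw [mutateVar_self]
      refine mul_mem ?_ (S.exchange_mem_of i _ fun k _ => hvar k)
      cases l with
      | none => exact S.inv_var_mem_laurent _
      | some j =>
        have hij : Sum.inl i ≠ (Sum.inl j : Fin n ⊕ Fin m) := fun h =>
          hl (congrArg some (Sum.inl_injective h).symm)
        change _ ∈ (S.mutate j).laurent
        rw [← S.mutateVar_of_ne hij]
        exact (S.mutate j).inv_var_mem_laurent _
    · rw [mutateVar_of_ne _ hr]
      exact hvar r

end Mutation

end Seed

/-! ### Intersecting two adjacent Laurent polynomial rings -/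

open Polynomial in
/-- Let `x` be transcendental over a subring `R` of a field, and let `p` be a nonzero element of
`R`. A Laurent polynomial in `x` over `R` that is also a Laurent polynomial in `p / x` is a
polynomial in `x` and `p / x`. -/
theorem mem_of_laurent_of_laurent_div {F : Type*} [Field F] {R D : Subring F} {x p f : F}
    (hx : Transcendental R x) (hp : p ∈ R) (hp0 : p ≠ 0) (hRD : R ≤ D) (hxD : x ∈ D)
    (hyD : p / x ∈ D) {N : ℕ} {A B : R[X]} (hA : x ^ N * f = aeval x A)
    (hB : (p / x) ^ N * f = aeval (p / x) B) : f ∈ D := by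
  have hx0 : x ≠ 0 := fun h => hx (h ▸ isAlgebraic_zero)
  let P : R := ⟨p, hp⟩
  have hP0 : P ≠ 0 := fun h => hp0 (congrArg Subtype.val h)
  set M := B.natDegree with hM
  -- Both expressions for `f`, multiplied by `p ^ N * x ^ (N + M)`, are polynomials in `x`.
  have hpoly : C (P ^ N) * X ^ M * A =
      ∑ k ∈ Finset.range (M + 1), C (B.coeff k * P ^ k) * X ^ (2 * N + M - k) := by
    refine transcendental_iff_injective.1 hx ?_
    have hAP (r : R) : algebraMap R F r = r := rfl
    simp only [map_mul, map_pow, aeval_X, aeval_C, map_sum, hAP]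
    rw [← hA]
    have h2 : p ^ N * x ^ M * (x ^ N * f) = x ^ (2 * N + M) * ((p / x) ^ N * f) := by
      rw [div_pow]; field_simp; ring
    change p ^ N * _ * _ = _
    rw [h2, hB, aeval_eq_sum_range, Finset.mul_sum]
    refine Finset.sum_congr rfl fun k hk => ?_
    have hk' : k ≤ 2 * N + M := by have := Finset.mem_range.1 hk; lia
    rw [Algebra.smul_def, hAP]
    have hsplit : x ^ (2 * N + M) = x ^ (2 * N + M - k) * x ^ k := by
      rw [← pow_add, Nat.sub_add_cancel hk']
    rw [hsplit, div_pow]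
    change _ = (B.coeff k : F) * p ^ k * _
    field_simp
  have hcoeff : ∀ j < N, A.coeff j = B.coeff (2 * N - j) * P ^ (N - j) := by
    intro j hj
    have h := congrArg (fun q => q.coeff (j + M)) hpoly
    simp only [finsetSum_coeff, coeff_C_mul, coeff_X_pow, mul_assoc, mul_comm (X ^ M),
      coeff_mul_X_pow] at h
    rw [Finset.sum_eq_single (2 * N - j)] at h
    · rw [if_pos (by lia), mul_one] at h
      have hsplit : P ^ (2 * N - j) = P ^ N * P ^ (N - j) := by
        rw [← pow_add]; congr 1; lia
      rw [hsplit] at h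
      refine mul_left_cancel₀ (pow_ne_zero N hP0) ?_
      linear_combination h
    · intro k hk hne
      have := Finset.mem_range.1 hk
      rw [if_neg (by lia)]
      simp
    · intro hk
      have : M < 2 * N - j := by
        by_contra! hc
        exact hk (Finset.mem_range.2 (by lia))
      rw [coeff_eq_zero_of_natDegree_lt (hM ▸ this)]
      simp
  have hf : f = ∑ j ∈ Finset.range (A.natDegree + 1), (A.coeff j : F) * x ^ j / x ^ N := by
    rw [← Finset.sum_div, eq_div_iff (pow_ne_zero N hx0), mul_comm, hA, aeval_eq_sum_range]
    rfl
  rw [hf]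
  refine sum_mem fun j _ => ?_
  rcases lt_or_ge j N with hj | hj
  · have hterm : (A.coeff j : F) * x ^ j / x ^ N = B.coeff (2 * N - j) * (p / x) ^ (N - j) := by
      have hsplit : x ^ N = x ^ (N - j) * x ^ j := by rw [← pow_add, Nat.sub_add_cancel hj.le]
      rw [hcoeff j hj, hsplit, div_pow]
      change (B.coeff (2 * N - j) : F) * p ^ (N - j) * _ / _ = _
      field_simp
    rw [hterm]
    exact mul_mem (hRD (B.coeff _).2) (pow_mem hyD _)
  · have hterm : (A.coeff j : F) * x ^ j / x ^ N = A.coeff j * x ^ (j - N) := by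
      have hsplit : x ^ j = x ^ (j - N) * x ^ N := by rw [← pow_add, Nat.sub_add_cancel hj]
      rw [hsplit]
      field_simp
    rw [hterm]
    exact mul_mem (hRD (A.coeff _).2) (pow_mem hxD _)

namespace Seed

variable {K F : Type*} [CommRing K] [Field F] [Algebra K F] {n m : ℕ}

/-- The Laurent polynomials in all the variables of a seed but the one in direction `j`. -/
def laurentCompl (S : Seed K F n m) (j : Fin n) : Subalgebra K F :=
  Algebra.adjoin K (S.var '' {Sum.inl j}ᶜ ∪ (fun k => (S.var k)⁻¹) '' {Sum.inl j}ᶜ)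

theorem var_mem_laurentCompl (S : Seed K F n m) {j : Fin n} {k} (hk : k ≠ Sum.inl j) :
    S.var k ∈ S.laurentCompl j :=
  Algebra.subset_adjoin (Or.inl ⟨k, hk, rfl⟩)

theorem inv_var_mem_laurentCompl (S : Seed K F n m) {j : Fin n} {k} (hk : k ≠ Sum.inl j) :
    (S.var k)⁻¹ ∈ S.laurentCompl j :=
  Algebra.subset_adjoin (Or.inr ⟨k, hk, rfl⟩)

theorem laurentCompl_le {S : Seed K F n m} {j : Fin n} {A : Subalgebra K F}
    (h : ∀ k ≠ Sum.inl j, S.var k ∈ A) (h' : ∀ k ≠ Sum.inl j, (S.var k)⁻¹ ∈ A) :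
    S.laurentCompl j ≤ A := by
  refine Algebra.adjoin_le ?_
  rintro _ (⟨k, hk, rfl⟩ | ⟨k, hk, rfl⟩)
  exacts [h k hk, h' k hk]

theorem transcendental_var_laurentCompl (S : Seed K F n m) (j : Fin n) :
    Transcendental (S.laurentCompl j) (S.var (Sum.inl j)) := by
  have : IsDomain K := S.algebraicIndependent.algebraMap_injective.isDomain (algebraMap K F)
  have h := ((AlgebraicIndependent.iff_transcendental_adjoin_image (Sum.inl j)).1
    S.algebraicIndependent).2
  refine fun halg => h (halg.adjoin_of_forall_isAlgebraic ?_)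
  rintro _ ⟨⟨k, hk, rfl⟩ | ⟨k, hk, rfl⟩, hnot⟩
  · exact absurd ⟨k, hk, rfl⟩ hnot
  · exact IsAlgebraic.inv (isAlgebraic_algebraMap (⟨S.var k, Algebra.subset_adjoin ⟨k, hk, rfl⟩⟩ :
      Algebra.adjoin K (S.var '' {Sum.inl j}ᶜ)))

open Polynomial in
theorem exists_pow_mul_eq_aeval {S : Seed K F n m} {j : Fin n} {R : Subalgebra K F}
    (hR : S.laurentCompl j ≤ R) {f : F} (hf : f ∈ S.laurent) :
    ∃ N, ∀ N' ≥ N, ∃ A : R[X], S.var (Sum.inl j) ^ N' * f = aeval (S.var (Sum.inl j)) A := by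
  set x := S.var (Sum.inl j)
  let E : Subalgebra K F := (aeval (R := R) x).range.restrictScalars K
  have hRE : ∀ r ∈ R, r ∈ E := fun r hr => ⟨C ⟨r, hr⟩, by simp⟩
  have hxE : x ∈ E := ⟨X, by simp⟩
  have hle : S.laurent ≤ E.away ⟨x, hxE⟩ := by
    refine laurent_le (fun k => ?_) fun k => ?_ <;> by_cases hk : k = Sum.inl j
    · subst hk; exact E.le_away _ hxE
    · exact E.le_away _ (hRE _ (hR (S.var_mem_laurentCompl hk)))
    · subst hk; exact E.inv_mem_away ⟨x, hxE⟩
    · exact E.le_away _ (hRE _ (hR (S.inv_var_mem_laurentCompl hk)))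
  obtain ⟨N, hN⟩ := hle hf
  refine ⟨N, fun N' hN' => ?_⟩
  have hmem : x ^ N' * f ∈ E := by
    have := mul_mem (pow_mem hxE (N' - N)) hN
    rwa [← mul_assoc, ← pow_add, Nat.sub_add_cancel hN'] at this
  obtain ⟨A, hA⟩ := hmem
  exact ⟨A, hA.symm⟩

/-- The intersection of the Laurent polynomial rings of two adjacent seeds is generated by the
common variables, their inverses, and the two exchanged variables. -/
theorem mem_of_mem_laurent_of_mem_laurent_mutate [CharZero K] {S : Seed K F n m} {j : Fin n}
    {D : Subalgebra K F} (hD : ∀ k, S.var k ∈ D) (hinv : ∀ k ≠ Sum.inl j, (S.var k)⁻¹ ∈ D)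
    (hD' : S.mutateVar j (Sum.inl j) ∈ D) {f : F} (hf : f ∈ S.laurent)
    (hf' : f ∈ (S.mutate j).laurent) : f ∈ D := by
  have hle : (S.mutate j).laurentCompl j ≤ S.laurentCompl j := by
    refine laurentCompl_le (fun k hk => ?_) fun k hk => ?_ <;> rw [mutate_var, mutateVar_of_ne S hk]
    exacts [S.var_mem_laurentCompl hk, S.inv_var_mem_laurentCompl hk]
  obtain ⟨N₁, h₁⟩ := exists_pow_mul_eq_aeval (S := S) (j := j) le_rfl hf
  obtain ⟨N₂, h₂⟩ := exists_pow_mul_eq_aeval hle hf'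
  obtain ⟨A, hA⟩ := h₁ (max N₁ N₂) (le_max_left _ _)
  obtain ⟨B, hB⟩ := h₂ (max N₁ N₂) (le_max_right _ _)
  have hdiv : (S.mutate j).var (Sum.inl j) = S.exchange j / S.var (Sum.inl j) := by
    rw [mutate_var, mutateVar_self, div_eq_inv_mul]
  rw [hdiv] at hB
  exact mem_of_laurent_of_laurent_div (R := (S.laurentCompl j).toSubring) (D := D.toSubring)
    (S.transcendental_var_laurentCompl j)
    (S.exchange_mem_of j (S.laurentCompl j) fun k hk => S.var_mem_laurentCompl hk)
    (S.exchange_ne_zero j) (laurentCompl_le (fun k _ => hD k) hinv) (hD _)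
    (by rw [← hdiv]; exact hD') hA hB

end Seed

/-! ### Coprimality of exchange polynomials -/

open LaurentPolynomial in
theorem LaurentPolynomial.eq_zero_of_binomial_mul_eq_zero {A : Type*} [CommRing A] {u v : A}
    (hu : IsUnit u) (hv : IsUnit v) {a b : ℤ} (hab : a ≠ b) {h : A[T;T⁻¹]}
    (h0 : (C u * T a + C v * T b) * h = 0) : h = 0 := by
  have hcoeff : ∀ k, u * h.coeff (-a + k) + v * h.coeff (-b + k) = 0 := fun k => by
    have := congrArg (fun q : A[T;T⁻¹] => q.coeff k) h0
    rw [← single_eq_C_mul_T, ← single_eq_C_mul_T, add_mul] at this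
    simpa [-single_eq_C_mul_T] using this
  -- The top coefficient of `h` meets only the term of higher degree.
  by_contra hne
  have hne' : h.coeff.support.Nonempty := by
    rw [Finsupp.support_nonempty_iff]
    exact fun hc => hne (by ext k; simp [hc])
  set t := h.coeff.support.max' hne' with ht
  have hmem : h.coeff t ≠ 0 := Finsupp.mem_support_iff.1 (Finset.max'_mem _ hne')
  have htop : ∀ k, t < k → h.coeff k = 0 := fun k hk => by
    by_contra hc
    exact absurd (Finset.le_max' _ k (Finsupp.mem_support_iff.2 hc)) (not_le.2 hk)
  rcases hab.lt_or_gt with hlt | hlt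
  · have := hcoeff (b + t)
    rw [htop (-a + (b + t)) (by lia), neg_add_cancel_left, mul_zero, zero_add] at this
    exact hmem ((hv.mul_right_eq_zero).1 this)
  · have := hcoeff (a + t)
    rw [htop (-b + (a + t)) (by lia), neg_add_cancel_left, mul_zero, add_zero] at this
    exact hmem ((hu.mul_right_eq_zero).1 this)

namespace Seed

variable {K F : Type*} [CommRing K] [Field F] [Algebra K F] {n m : ℕ}

/-- The binomial `∏ x_k ^ [α_k]₊ + ∏ x_k ^ [-α_k]₊`, in the Laurent polynomial ring of a seed with
variables `x_k`. -/
noncomputable def binomial (S : Seed K F n m) (α : Fin n ⊕ Fin m → ℤ) : S.laurent :=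
  ∏ k, ⟨S.var k, S.var_mem_laurent k⟩ ^ (α k).toNat +
    ∏ k, ⟨S.var k, S.var_mem_laurent k⟩ ^ (-α k).toNat

/-- Binomials with linearly independent exponent vectors are coprime. An integral grading `ℓ` of the
Laurent polynomials for which the first binomial is homogeneous and the second one is not passes to
the quotient by the first, where the second is a sum of two units of different degrees. -/
theorem binomial_dvd_of_dvd_mul (S : Seed K F n m) {α β : Fin n ⊕ Fin m → ℤ}
    (hαβ : ∀ a b : ℤ, (∀ k, a * α k + b * β k = 0) → a = 0 ∧ b = 0) {h : S.laurent}
    (hdvd : S.binomial α ∣ S.binomial β * h) : S.binomial α ∣ h := by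
  classical
  -- `ℓ` is the `2 × 2` minor of `α` and a varying vector, in two rows where `α` and `β` have a
  -- nonzero minor.
  obtain ⟨a, ha⟩ : ∃ a, α a ≠ 0 := by
    by_contra! hα
    exact one_ne_zero (hαβ 1 0 fun k => by simp [hα]).1
  obtain ⟨b, hb⟩ : ∃ b, α a * β b - α b * β a ≠ 0 := by
    by_contra! hβ
    exact ha (hαβ (-β a) (α a) fun k => by linear_combination hβ k).2
  let ℓ : Fin n ⊕ Fin m → ℤ := fun k => (if k = b then α a else 0) - (if k = a then α b else 0)
  have hℓ : ∀ γ : Fin n ⊕ Fin m → ℤ, ∑ k, ℓ k * γ k = α a * γ b - α b * γ a := fun γ => by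
    simp [ℓ, sub_mul, Finset.sum_sub_distrib]
  let I : Ideal S.laurent := Ideal.span {S.binomial α}
  have hunit : ∀ k, IsUnit (⟨S.var k, S.var_mem_laurent k⟩ : S.laurent) := fun k =>
    IsUnit.of_mul_eq_one ⟨_, S.inv_var_mem_laurent k⟩
      (Subtype.ext (mul_inv_cancel₀ (S.var_ne_zero k)))
  let π : S.laurent →ₐ[K] S.laurent ⧸ I := Ideal.Quotient.mkₐ K I
  let u : Fin n ⊕ Fin m → (S.laurent ⧸ I)ˣ := fun k => ((hunit k).map π).unit
  have hu : ∀ k, (u k : S.laurent ⧸ I) = π ⟨S.var k, S.var_mem_laurent k⟩ := fun k => rfl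
  let w : Fin n ⊕ Fin m → (LaurentPolynomial (S.laurent ⧸ I))ˣ := fun k =>
    Units.map LaurentPolynomial.C.toMonoidHom (u k) * (LaurentPolynomial.isUnit_T (ℓ k)).unit
  have hw : ∀ k, (w k : LaurentPolynomial (S.laurent ⧸ I)) =
      LaurentPolynomial.C (u k : S.laurent ⧸ I) * LaurentPolynomial.T (ℓ k) := fun k => rfl
  obtain ⟨φ, hφ⟩ := S.exists_algHom_laurent (A := LaurentPolynomial (S.laurent ⧸ I)) w
  have hmono : ∀ e : Fin n ⊕ Fin m → ℕ,
      φ (∏ k, ⟨S.var k, S.var_mem_laurent k⟩ ^ e k) =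
        LaurentPolynomial.C (π (∏ k, ⟨S.var k, S.var_mem_laurent k⟩ ^ e k)) *
          LaurentPolynomial.T (∑ k, ℓ k * e k) := fun e => by
    have hT : (LaurentPolynomial.T (∑ k, ℓ k * e k) : LaurentPolynomial (S.laurent ⧸ I)) =
        ∏ k, LaurentPolynomial.T (ℓ k) ^ e k := by
      simp only [LaurentPolynomial.T_pow]
      induction (Finset.univ : Finset (Fin n ⊕ Fin m)) using Finset.induction_on with
      | empty => simp
      | insert k s hk ih =>
        rw [Finset.sum_insert hk, Finset.prod_insert hk, LaurentPolynomial.T_add, ih,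
          mul_comm (ℓ k)]
    simp only [map_prod, map_pow, hφ, hw, hu, hT]
    rw [← Finset.prod_mul_distrib]
    exact Finset.prod_congr rfl fun k _ => mul_pow (M := LaurentPolynomial (S.laurent ⧸ I)) _ _ _
  have hdeg : ∀ γ : Fin n ⊕ Fin m → ℤ, ∑ k, ℓ k * ((γ k).toNat : ℤ) -
      ∑ k, ℓ k * ((-γ k).toNat : ℤ) = α a * γ b - α b * γ a := fun γ => by
    rw [← hℓ, ← Finset.sum_sub_distrib]
    refine Finset.sum_congr rfl fun k _ => ?_
    rw [← mul_sub]
    congr 1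
    lia
  have hφα : φ (S.binomial α) = 0 := by
    have h1 := hdeg α
    rw [mul_comm (α b), sub_self, sub_eq_zero] at h1
    have h2 : π (S.binomial α) = 0 :=
      Ideal.Quotient.eq_zero_iff_mem.2 (Ideal.mem_span_singleton_self _)
    rw [binomial, map_add] at h2
    rw [binomial, map_add, hmono, hmono, h1, ← add_mul, ← map_add, h2, map_zero, zero_mul]
  have hφh : φ h = 0 := by
    obtain ⟨g, hg⟩ := hdvd
    have h1 : φ (S.binomial β) * φ h = 0 := by
      rw [← map_mul, hg, map_mul, hφα, zero_mul]
    rw [binomial, map_add, hmono, hmono] at h1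
    have hu' : ∀ e : Fin n ⊕ Fin m → ℕ,
        IsUnit (π (∏ k, ⟨S.var k, S.var_mem_laurent k⟩ ^ e k)) := fun e => by
      refine IsUnit.map π ?_
      exact Finset.prod_induction _ IsUnit (fun _ _ => IsUnit.mul) isUnit_one
        fun k _ => (hunit k).pow _
    exact LaurentPolynomial.eq_zero_of_binomial_mul_eq_zero (hu' _) (hu' _)
      (fun hc => hb (by rw [← hdeg β, hc, sub_self])) h1
  -- Forgetting the grading recovers the class of `h` modulo the first binomial.
  have hev : ∀ x, LaurentPolynomial.eval₂ (RingHom.id (S.laurent ⧸ I)) 1 (φ x) = π x := fun x => by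
    let ev : LaurentPolynomial (S.laurent ⧸ I) →ₐ[K] S.laurent ⧸ I :=
      { LaurentPolynomial.eval₂ (RingHom.id (S.laurent ⧸ I)) 1 with
        commutes' := fun c => by
          change LaurentPolynomial.eval₂ (RingHom.id (S.laurent ⧸ I)) 1
            (LaurentPolynomial.C (algebraMap K _ c)) = _
          simp }
    have : ev.comp φ = π := algHom_laurent_ext fun k => by
      change LaurentPolynomial.eval₂ (RingHom.id (S.laurent ⧸ I)) 1 (φ _) = _
      rw [hφ, hw, map_mul, LaurentPolynomial.eval₂_T]
      simp [hu]
    exact DFunLike.congr_fun this x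
  have hπ : π h = 0 := by rw [← hev, hφh, map_zero]
  exact Ideal.mem_span_singleton.1 (Ideal.Quotient.eq_zero_iff_mem.1 hπ)

end Seed

/-! ### Invariance of the upper bound under mutation -/

namespace Seed

variable {K F : Type*} [CommRing K] [Field F] [Algebra K F] {n m : ℕ}

theorem zpow_sub_one_div_mem {A : Subalgebra K F} {v x : F} (hv : v ∈ A) (hinv : v⁻¹ ∈ A)
    (h : (v - 1) / x ∈ A) (e : ℤ) : (v ^ e - 1) / x ∈ A := by
  have hnat : ∀ N : ℕ, (v ^ N - 1) / x ∈ A := fun N => by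
    rw [← mul_geom_sum, mul_comm, mul_div_assoc, mul_comm, mul_comm]
    exact mul_mem (sum_mem fun k _ => pow_mem hv k) h
  by_cases hv0 : v = 0
  · subst hv0
    rcases eq_or_ne e 0 with rfl | he
    · simp
    · simpa [zero_zpow e he] using h
  obtain ⟨N, rfl | rfl⟩ := e.eq_nat_or_neg
  · simpa using hnat N
  · have : (v ^ (-(N : ℤ)) - 1) / x = -(v⁻¹ ^ N * ((v ^ N - 1) / x)) := by
      rw [zpow_neg, zpow_natCast, inv_pow]
      have := pow_ne_zero N hv0
      field_simp
      ring
    rw [this]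
    exact neg_mem (mul_mem (pow_mem hinv N) (hnat N))

/-- The monomial `∏ x_k ^ b_kj` in the variables of a seed. -/
noncomputable def yhat (S : Seed K F n m) (j : Fin n) : F :=
  ∏ k, S.var k ^ S.B k j

theorem exchange_eq (S : Seed K F n m) (j : Fin n) :
    S.exchange j = (∏ k, S.var k ^ (-S.B k j).toNat) * (1 + S.yhat j) := by
  rw [exchange, yhat, mul_add, mul_one, add_comm, ← Finset.prod_mul_distrib]
  congr 1
  refine Finset.prod_congr rfl fun k _ => ?_
  rw [← zpow_natCast, ← zpow_natCast, ← zpow_add₀ (S.var_ne_zero k)]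
  congr 1
  lia

variable [CharZero K]

/-- The mutation rule for the monomials `∏ x_k ^ b_kj`. The exponents `e` are those of one of the
two terms of the exchange polynomial in direction `i`. -/
theorem yhat_mutate (S : Seed K F n m) {i j : Fin n} {e : Fin n ⊕ Fin m → ℕ}
    (hei : e (Sum.inl i) = 0)
    (he : ∀ k ≠ Sum.inl i, mutateMatrix S.B i k j = S.B k j + e k * S.B (Sum.inl i) j) :
    (S.mutate i).yhat j =
      S.yhat j * ((∏ k, S.var k ^ e k) / S.exchange i) ^ S.B (Sum.inl i) j := by
  set b := S.B (Sum.inl i) j with hb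
  have hu : (∏ k, S.var k ^ e k) ^ b = ∏ k, S.var k ^ (e k * b : ℤ) := by
    rw [← Finset.prod_zpow]
    refine Finset.prod_congr rfl fun k _ => ?_
    rw [zpow_mul, zpow_natCast]
  rw [div_zpow, hu, ← var_mul_mutateVar, mul_zpow, yhat, yhat,
    ← Finset.mul_prod_erase _ _ (Finset.mem_univ (Sum.inl i)),
    ← Finset.mul_prod_erase _ (fun k => S.var k ^ S.B k j) (Finset.mem_univ (Sum.inl i)),
    ← Finset.mul_prod_erase _ (fun k => S.var k ^ (e k * b : ℤ)) (Finset.mem_univ (Sum.inl i)),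
    hei, mutate_B, mutateMatrix_row, mutate_var, ← hb]
  have hprod : ∏ k ∈ Finset.univ.erase (Sum.inl i), S.mutateVar i k ^ mutateMatrix S.B i k j =
      (∏ k ∈ Finset.univ.erase (Sum.inl i), S.var k ^ S.B k j) *
        ∏ k ∈ Finset.univ.erase (Sum.inl i), S.var k ^ (e k * b : ℤ) := by
    rw [← Finset.prod_mul_distrib]
    refine Finset.prod_congr rfl fun k hk => ?_
    have hk' := (Finset.mem_erase.1 hk).1
    rw [mutateVar_of_ne S hk', he k hk', zpow_add₀ (S.var_ne_zero k)]
  have h1 := zpow_ne_zero b (S.var_ne_zero (Sum.inl i))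
  have h2 := zpow_ne_zero b (S.mutateVar_ne_zero i (Sum.inl i))
  rw [hprod, zpow_neg]
  simp only [Nat.cast_zero, zero_mul, zpow_zero, one_mul]
  field_simp

theorem var_mem_mutate_mutate (S : Seed K F n m) (i j : Fin n) (k : Fin n ⊕ Fin m) :
    S.var k ∈ ((S.mutate i).mutate j).laurent := by
  have h := (S.mutate i).neighbor_var_mem (some i) (some j) k
  change ((S.mutate i).mutate i).var k ∈ _ at h
  rwa [mutate_mutate] at h

theorem inv_var_mem_mutate_mutate (S : Seed K F n m) {i j : Fin n} {k : Fin n ⊕ Fin m}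
    (hi : k ≠ Sum.inl i) (hj : k ≠ Sum.inl j) :
    (S.var k)⁻¹ ∈ ((S.mutate i).mutate j).laurent := by
  have h := ((S.mutate i).mutate j).inv_var_mem_laurent k
  rwa [mutate_var, mutateVar_of_ne _ hj, mutate_var, mutateVar_of_ne _ hi] at h

/-- The variable obtained by mutation in direction `j` lies in `L[1/x_i]`, where `L` is the Laurent
polynomial ring after mutation in directions `i` and `j`. By the mutation rule for the monomials
`∏ x_k ^ b_kj`, the exchange polynomials in direction `j` before and after mutation in direction `i`
agree modulo `x_j` up to a unit of `L[1/x_i]`. -/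
theorem mutateVar_mem_away (S : Seed K F n m) {i j : Fin n} (hij : i ≠ j) :
    S.mutateVar j (Sum.inl j) ∈ ((S.mutate i).mutate j).laurent.away
      ⟨S.var (Sum.inl i), S.var_mem_mutate_mutate i j _⟩ := by
  set L := ((S.mutate i).mutate j).laurent with hL
  set M := L.away ⟨S.var (Sum.inl i), S.var_mem_mutate_mutate i j _⟩ with hM
  have hji : (Sum.inl j : Fin n ⊕ Fin m) ≠ Sum.inl i := fun h => hij (Sum.inl_injective h).symm
  have hLM : L ≤ M := L.le_away _
  have hvar : ∀ k, S.var k ∈ M := fun k => hLM (S.var_mem_mutate_mutate i j k)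
  have hinv : ∀ k ≠ Sum.inl j, (S.var k)⁻¹ ∈ M := fun k hk => by
    by_cases hki : k = Sum.inl i
    · subst hki
      exact L.inv_mem_away ⟨S.var (Sum.inl i), S.var_mem_mutate_mutate i j _⟩
    · exact hLM (S.inv_var_mem_mutate_mutate hki hk)
  have hTinv : ∀ k ≠ Sum.inl j, (S.mutateVar i k)⁻¹ ∈ M := fun k hk => by
    have h := ((S.mutate i).mutate j).inv_var_mem_laurent k
    rw [mutate_var, mutateVar_of_ne _ hk] at h
    exact hLM h
  have hPinv : (S.exchange i)⁻¹ ∈ M := by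
    rw [← var_mul_mutateVar, mul_inv]
    exact mul_mem (hinv _ hji.symm) (hTinv _ hji.symm)
  set b := S.B (Sum.inl i) j with hb
  set x := S.var (Sum.inl j) with hx
  have hx0 : x ≠ 0 := S.var_ne_zero _
  -- If `u`, `w` are the two terms of the exchange polynomial in direction `i`, where `x_j` divides
  -- `w` and not `u`, then `u / (u + w)` is a unit of `M` congruent to `1` modulo `x_j`.
  have key : ∀ e e' : Fin n ⊕ Fin m → ℕ, e (Sum.inl j) = 0 → e' (Sum.inl j) ≠ 0 →
      S.exchange i = ∏ k, S.var k ^ e k + ∏ k, S.var k ^ e' k →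
      (((∏ k, S.var k ^ e k) / S.exchange i) ^ b - 1) / x ∈ M := by
    intro e e' he he' hP
    have huM : ∏ k, S.var k ^ e k ∈ M := prod_mem fun k _ => pow_mem (hvar k) _
    have huinv : (∏ k, S.var k ^ e k)⁻¹ ∈ M := by
      rw [← Finset.prod_inv_distrib]
      refine prod_mem fun k _ => ?_
      by_cases hk : k = Sum.inl j
      · rw [hk, he, pow_zero, inv_one]; exact one_mem M
      · rw [← inv_pow]; exact pow_mem (hinv k hk) _
    have hP0 := S.exchange_ne_zero i
    refine zpow_sub_one_div_mem ?_ ?_ ?_ b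
    · rw [div_eq_mul_inv]
      exact mul_mem huM hPinv
    · rw [inv_div, div_eq_mul_inv]
      exact mul_mem (S.exchange_mem_of i M fun k _ => hvar k) huinv
    · obtain ⟨r, hr⟩ := Nat.exists_eq_succ_of_ne_zero he'
      have hw : ∏ k, S.var k ^ e' k =
          x * (x ^ r * ∏ k ∈ Finset.univ.erase (Sum.inl j), S.var k ^ e' k) := by
        rw [← Finset.mul_prod_erase _ _ (Finset.mem_univ (Sum.inl j)), hr, pow_succ]
        ring
      have heq : ((∏ k, S.var k ^ e k) / S.exchange i - 1) / x =
          -((x ^ r * ∏ k ∈ Finset.univ.erase (Sum.inl j), S.var k ^ e' k) *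
            (S.exchange i)⁻¹) := by
        rw [hw] at hP
        field_simp
        rw [hP]
        ring
      rw [heq]
      exact neg_mem (mul_mem (mul_mem (pow_mem (hvar _) _)
        (prod_mem fun k _ => pow_mem (hvar k) _)) hPinv)
  obtain ⟨v, hv, hvM⟩ : ∃ v : F, (S.mutate i).yhat j = S.yhat j * v ∧ (v - 1) / x ∈ M := by
    have hpos : 0 < b → S.B (Sum.inl j) i < 0 := (S.B_pos_iff i j).1
    have hneg : b < 0 → 0 < S.B (Sum.inl j) i := (S.B_pos_iff j i).2
    rcases le_or_gt b 0 with hb0 | hb0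
    · refine ⟨_, S.yhat_mutate (e := fun k => (-S.B k i).toNat) (by simp [B_diag])
        fun k hk => ?_, ?_⟩
      · rw [mutateMatrix_of_ne hk hij.symm, max_eq_right hb0]
        simp
      · rcases hb0.lt_or_eq with hb1 | hb1
        · exact key _ (fun k => (S.B k i).toNat) (by lia) (by lia) (by rw [exchange, add_comm])
        · rw [← hb, hb1]
          simp
    · refine ⟨_, S.yhat_mutate (e := fun k => (S.B k i).toNat) (by simp [B_diag])
        fun k hk => ?_, ?_⟩
      · rw [mutateMatrix_of_ne hk hij.symm, max_eq_left hb0.le, add_assoc, ← add_mul]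
        congr 2
        lia
      · exact key _ (fun k => (-S.B k i).toNat) (by lia) (by lia) rfl
  have hy : S.yhat j ∈ M := by
    refine prod_mem fun k _ => ?_
    by_cases hk : k = Sum.inl j
    · rw [hk, B_diag, zpow_zero]; exact one_mem M
    · exact M.zpow_mem (hvar k) (hinv k hk) _
  set q := ∏ k, (S.mutate i).var k ^ (-(S.mutate i).B k j).toNat with hq
  have hqinv : q⁻¹ ∈ M := by
    rw [hq, ← Finset.prod_inv_distrib]
    refine prod_mem fun k _ => ?_
    by_cases hk : k = Sum.inl j
    · rw [hk, B_diag]; simp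
    · rw [← inv_pow]; exact pow_mem (hTinv k hk) _
  have hq0 : q ≠ 0 :=
    Finset.prod_ne_zero_iff.2 fun k _ => pow_ne_zero _ ((S.mutate i).var_ne_zero k)
  have hW : x * ((S.mutate i).mutate j).var (Sum.inl j) = q * (1 + S.yhat j * v) := by
    rw [← hv, hq, ← exchange_eq, ← var_mul_mutateVar, mutate_var _ i, mutateVar_of_ne S hji]
    rfl
  have heq : S.mutateVar j (Sum.inl j) = (∏ k, S.var k ^ (-S.B k j).toNat) *
      (q⁻¹ * ((S.mutate i).mutate j).var (Sum.inl j) - S.yhat j * ((v - 1) / x)) := by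
    rw [mutateVar_self, exchange_eq, ← hx]
    field_simp
    linear_combination -(∏ k, S.var k ^ (-S.B k j).toNat) * hW
  rw [heq]
  exact mul_mem (prod_mem fun k _ => pow_mem (hvar k) _)
    (sub_mem (mul_mem hqinv (hLM (((S.mutate i).mutate j).var_mem_laurent _))) (mul_mem hy hvM))

/-- The linear independence over `ℤ` of the columns of the exchange matrix. -/
def IndependentColumns (S : Seed K F n m) : Prop :=
  ∀ v : Fin n → ℤ, (∀ k, ∑ j, v j * S.B k j = 0) → v = 0

theorem IndependentColumns.mutate {S : Seed K F n m} (hS : S.IndependentColumns) (i : Fin n) :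
    (S.mutate i).IndependentColumns := by
  intro v hv
  have hrow : ∑ j, v j * S.B (Sum.inl i) j = 0 := by
    have h := hv (Sum.inl i)
    simp only [mutate_B, mutateMatrix_row, mul_neg, Finset.sum_neg_distrib, neg_eq_zero] at h
    exact h
  set c := ∑ j, v j * max (S.B (Sum.inl i) j) 0 with hc
  -- The kernel of the mutated matrix is that of the matrix itself after a change of coordinates.
  have hw := hS (fun j => v j + if j = i then c - 2 * v i else 0) fun k => by
    simp only [add_mul, ite_mul, zero_mul, Finset.sum_add_distrib, Finset.sum_ite_eq',
      Finset.mem_univ, if_true]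
    by_cases hk : k = Sum.inl i
    · subst hk
      rw [hrow, B_diag, mul_zero, add_zero]
    · have h := hv k
      have hterm : ∀ j, v j * mutateMatrix S.B i k j = v j * S.B k j +
          S.B k i * (v j * max (S.B (Sum.inl i) j) 0) +
          max (-S.B k i) 0 * (v j * S.B (Sum.inl i) j) -
          (if j = i then 2 * v i * S.B k i else 0) := fun j => by
        by_cases hj : j = i
        · subst hj
          rw [mutateMatrix_col, B_diag, if_pos rfl]
          simp
          ring
        · rw [mutateMatrix_of_ne hk hj, if_neg hj]
          ring
      simp only [mutate_B, hterm, Finset.sum_sub_distrib, Finset.sum_add_distrib, ← Finset.mul_sum,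
        ← hc, hrow, Finset.sum_ite_eq', Finset.mem_univ, if_true] at h
      linear_combination h
  have hne : ∀ j ≠ i, v j = 0 := fun j hj => by simpa [hj] using congrFun hw j
  have hc0 : c = 0 := by
    rw [hc, Finset.sum_eq_single i (fun j _ hj => by rw [hne j hj, zero_mul])
      (fun h => absurd (Finset.mem_univ i) h), B_diag]
    simp
  funext j
  by_cases hj : j = i
  · subst hj
    have := congrFun hw j
    simp only [if_true, hc0, Pi.zero_apply] at this
    simp only [Pi.zero_apply]
    lia
  · exact hne j hj

/-- In the Laurent polynomial ring after mutation in directions `i`, `j`, the variables `x_i` and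
`x_j` are coprime. If `b_ij ≠ 0`, they generate the unit ideal by the exchange relation in
direction `i`; otherwise, they are associated to binomials with independent exponent vectors. -/
theorem div_var_mem_mutate_mutate {S : Seed K F n m} (hS : S.IndependentColumns) {i j : Fin n}
    (hij : i ≠ j) {h : F} (hh : h ∈ ((S.mutate i).mutate j).laurent)
    (hdiv : S.var (Sum.inl j) * h / S.var (Sum.inl i) ∈ ((S.mutate i).mutate j).laurent) :
    h / S.var (Sum.inl i) ∈ ((S.mutate i).mutate j).laurent := by
  set W := (S.mutate i).mutate j with hWdef
  have hji : (Sum.inl j : Fin n ⊕ Fin m) ≠ Sum.inl i := fun h => hij (Sum.inl_injective h).symm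
  have hvar : ∀ k, S.var k ∈ W.laurent := fun k => S.var_mem_mutate_mutate i j k
  have hx0 : S.var (Sum.inl i) ≠ 0 := S.var_ne_zero _
  have hxi' : S.mutateVar i (Sum.inl i) = W.var (Sum.inl i) := by
    rw [hWdef, mutate_var, mutateVar_of_ne _ hji.symm]; rfl
  have hP : S.var (Sum.inl i) * W.var (Sum.inl i) = S.exchange i := by
    rw [← var_mul_mutateVar, hxi']
  have hW : ∀ k, k ≠ Sum.inl i → k ≠ Sum.inl j → W.var k = S.var k := fun k hki hkj => by
    rw [hWdef, mutate_var, mutateVar_of_ne _ hkj, mutate_var, mutateVar_of_ne _ hki]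
  by_cases hb : S.B (Sum.inl j) i = 0
  · have hb' : S.B (Sum.inl i) j = 0 := (S.B_eq_zero_iff j i).1 hb
    have hcol : ∀ k, (S.mutate i).B k j = S.B k j := fun k => by
      by_cases hk : k = Sum.inl i
      · rw [hk, mutate_B, mutateMatrix_row, hb', neg_zero]
      · rw [mutate_B, mutateMatrix_of_ne hk hij.symm, hb']
        simp
    have hbin : ∀ T : Seed K F n m, ∀ l, (∀ k, T.B k l ≠ 0 → W.var k = T.var k) →
        (W.binomial (fun k => T.B k l) : F) = T.exchange l := fun T l hT => by
      have h1 (e : ℤ → ℕ) (he : e 0 = 0) :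
          ∏ k, W.var k ^ e (T.B k l) = ∏ k, T.var k ^ e (T.B k l) := by
        refine Finset.prod_congr rfl fun k _ => ?_
        by_cases h0 : T.B k l = 0
        · rw [h0, he, pow_zero, pow_zero]
        · rw [hT k h0]
      simp only [binomial, exchange, AddMemClass.coe_add, SubmonoidClass.coe_finsetProd,
        SubmonoidClass.coe_pow]
      rw [h1 _ rfl, h1 (fun a => (-a).toNat) rfl]
    have hbi : (W.binomial (fun k => S.B k i) : F) = S.exchange i := hbin S i fun k hk =>
      hW k (fun h => hk (h ▸ S.B_diag i)) (fun h => hk (h ▸ hb))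
    have hbj : (W.binomial (fun k => (S.mutate i).B k j) : F) = (S.mutate i).exchange j :=
      hbin _ j fun k hk => by
        have hkj : k ≠ Sum.inl j := by
          rintro rfl
          exact hk (B_diag _ j)
        rw [hWdef, mutate_var, mutateVar_of_ne _ hkj]
    have hPj : S.var (Sum.inl j) * W.var (Sum.inl j) = (S.mutate i).exchange j := by
      rw [← var_mul_mutateVar, mutate_var S i, mutateVar_of_ne S hji]; rfl
    have hdvd : W.binomial (fun k => S.B k i) ∣ W.binomial (fun k => S.B k j) * ⟨h, hh⟩ := by
      refine ⟨⟨_, hdiv⟩ * ⟨_, W.var_mem_laurent (Sum.inl j)⟩ *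
        ⟨_, W.inv_var_mem_laurent (Sum.inl i)⟩, Subtype.ext ?_⟩
      simp only [← hcol, MulMemClass.coe_mul, hbj]
      rw [hbi, ← hPj, ← hP]
      have := W.var_ne_zero (Sum.inl i)
      field_simp
    obtain ⟨g, hg⟩ := W.binomial_dvd_of_dvd_mul (fun a c hac => by
      have := hS (Pi.single i a + Pi.single j c) fun k => by
        simpa [add_mul, Finset.sum_add_distrib, Pi.single_apply] using hac k
      have h1 := congrFun this i
      have h2 := congrFun this j
      simp [hij, hij.symm] at h1 h2
      exact ⟨h1, h2⟩) hdvd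
    have hg' : h = S.exchange i * g := by
      rw [← hbi]; exact congrArg Subtype.val hg
    rw [hg', ← hP, mul_assoc, mul_div_cancel_left₀ _ hx0]
    exact mul_mem (W.var_mem_laurent _) g.2
  · have key : ∀ e e' : Fin n ⊕ Fin m → ℕ, e (Sum.inl i) = 0 → e (Sum.inl j) = 0 →
        e' (Sum.inl j) ≠ 0 → S.exchange i = ∏ k, S.var k ^ e k + ∏ k, S.var k ^ e' k →
        h / S.var (Sum.inl i) ∈ W.laurent := by
      intro e e' hei hej hej' hPe
      obtain ⟨r, hr⟩ := Nat.exists_eq_succ_of_ne_zero hej'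
      have hw : ∏ k, S.var k ^ e' k = S.var (Sum.inl j) * (S.var (Sum.inl j) ^ r *
          ∏ k ∈ Finset.univ.erase (Sum.inl j), S.var k ^ e' k) := by
        rw [← Finset.mul_prod_erase _ _ (Finset.mem_univ (Sum.inl j)), hr, pow_succ]
        ring
      have huinv : (∏ k, S.var k ^ e k)⁻¹ ∈ W.laurent := by
        rw [← Finset.prod_inv_distrib]
        refine prod_mem fun k _ => ?_
        by_cases hki : k = Sum.inl i
        · rw [hki, hei, pow_zero, inv_one]; exact one_mem _
        by_cases hkj : k = Sum.inl j
        · rw [hkj, hej, pow_zero, inv_one]; exact one_mem _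
        · rw [← inv_pow]; exact pow_mem (S.inv_var_mem_mutate_mutate hki hkj) _
      have hu0 : ∏ k, S.var k ^ e k ≠ 0 :=
        Finset.prod_ne_zero_iff.2 fun k _ => pow_ne_zero _ (S.var_ne_zero k)
      have heq : h / S.var (Sum.inl i) = (∏ k, S.var k ^ e k)⁻¹ * (W.var (Sum.inl i) * h -
          (S.var (Sum.inl j) ^ r * ∏ k ∈ Finset.univ.erase (Sum.inl j), S.var k ^ e' k) *
            (S.var (Sum.inl j) * h / S.var (Sum.inl i))) := by
        rw [← hP, hw] at hPe
        field_simp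
        linear_combination (-h) * hPe
      rw [heq]
      exact mul_mem huinv (sub_mem (mul_mem (W.var_mem_laurent _) hh)
        (mul_mem (mul_mem (pow_mem (hvar _) _) (prod_mem fun k _ => pow_mem (hvar k) _)) hdiv))
    rcases lt_or_gt_of_ne hb with hb | hb
    · exact key (fun k => (S.B k i).toNat) (fun k => (-S.B k i).toNat) (by simp [B_diag])
        (by lia) (by lia) rfl
    · exact key (fun k => (-S.B k i).toNat) (fun k => (S.B k i).toNat) (by simp [B_diag])
        (by lia) (by lia) (by rw [exchange, add_comm])

/-- The crucial case of the invariance of the upper bound: `f` lies in `L[1/x_i]` and in `L[1/x_j]`,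
where `L` is the Laurent polynomial ring after mutation in directions `i` and `j`. -/
theorem mem_mutate_mutate {S : Seed K F n m} (hS : S.IndependentColumns) {i j : Fin n}
    (hij : i ≠ j) {f : F} (hf : f ∈ S.laurent) (hfi : f ∈ (S.mutate i).laurent)
    (hfj : f ∈ (S.mutate j).laurent) : f ∈ ((S.mutate i).mutate j).laurent := by
  set L := ((S.mutate i).mutate j).laurent with hL
  set x := S.var (Sum.inl i) with hx
  set y := S.var (Sum.inl j) with hy
  have hx0 : x ≠ 0 := S.var_ne_zero _
  have hji : (Sum.inl j : Fin n ⊕ Fin m) ≠ Sum.inl i := fun h => hij (Sum.inl_injective h).symm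
  have hxL : x ∈ L := S.var_mem_mutate_mutate i j _
  have hyL : y ∈ L := S.var_mem_mutate_mutate i j _
  obtain ⟨p, hp⟩ : f ∈ L.away ⟨x, hxL⟩ := by
    refine mem_of_mem_laurent_of_mem_laurent_mutate
      (fun k => L.le_away _ (S.var_mem_mutate_mutate i j k)) (fun k hk => ?_)
      (S.mutateVar_mem_away hij) hf hfj
    by_cases hki : k = Sum.inl i
    · subst hki; exact L.inv_mem_away ⟨x, hxL⟩
    · exact L.le_away _ (S.inv_var_mem_mutate_mutate hki hk)
  obtain ⟨q, hq⟩ : f ∈ L.away ⟨y, hyL⟩ := by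
    have hyT : (S.mutate i).var (Sum.inl j) = y := by rw [mutate_var, mutateVar_of_ne S hji]
    have hTL : ∀ k, (S.mutate i).var k ∈ L := fun k =>
      (S.mutate i).neighbor_var_mem none (some j) k
    refine laurent_le (fun k => L.le_away _ (hTL k)) (fun k => ?_) hfi
    by_cases hk : k = Sum.inl j
    · subst hk
      rw [hyT]
      exact L.inv_mem_away ⟨y, hyL⟩
    · refine L.le_away _ ?_
      have h := ((S.mutate i).mutate j).inv_var_mem_laurent k
      rwa [mutate_var, mutateVar_of_ne _ hk] at h
  have hcop : ∀ (r : ℕ) {h : F}, h ∈ L → y ^ r * h / x ∈ L → h / x ∈ L := by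
    intro r
    induction r with
    | zero => intro h hh hdiv; simpa using hdiv
    | succ r ih =>
      intro h hh hdiv
      refine ih hh (div_var_mem_mutate_mutate hS hij (mul_mem (pow_mem hyL r) hh) ?_)
      rwa [← mul_assoc, ← pow_succ']
  change x ^ p * f ∈ L at hp
  change y ^ q * f ∈ L at hq
  induction p with
  | zero => simpa using hp
  | succ p ih =>
    refine ih ?_
    have h1 : x ^ (p + 1) * f / x = x ^ p * f := by
      rw [pow_succ]; field_simp
    rw [← h1]
    refine hcop q hp ?_
    have h2 : y ^ q * (x ^ (p + 1) * f) / x = x ^ p * (y ^ q * f) := by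
      rw [pow_succ]; field_simp
    rw [h2]
    exact mul_mem (pow_mem hxL p) hq

/-- The upper bound of a seed with independent columns, the intersection of the Laurent polynomial
rings of the seed and its neighbors, does not grow under mutation. -/
theorem mem_neighbor_mutate {S : Seed K F n m} (hS : S.IndependentColumns) {f : F}
    (hf : ∀ k, f ∈ (S.neighbor k).laurent) (i : Fin n) (k : Option (Fin n)) :
    f ∈ ((S.mutate i).neighbor k).laurent := by
  cases k with
  | none => exact hf (some i)
  | some j =>
    by_cases hij : i = j
    · subst hij
      rw [neighbor, mutate_mutate]
      exact hf none
    · exact mem_mutate_mutate hS hij (hf none) (hf (some i)) (hf (some j))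

theorem IndependentColumns.mutationEquivalent {S T : Seed K F n m} (hS : S.IndependentColumns)
    (h : S.MutationEquivalent T) : T.IndependentColumns := by
  induction h with
  | refl => exact hS
  | tail _ hPQ ih =>
    obtain ⟨i, rfl⟩ := hPQ
    exact ih.mutate i

/-- The Laurent phenomenon for exchange matrices with independent columns. -/
theorem IndependentColumns.var_mem_laurent {S T : Seed K F n m} (hS : S.IndependentColumns)
    (h : S.MutationEquivalent T) (k : Fin n ⊕ Fin m) : S.var k ∈ T.laurent := by
  have hall : ∀ l, S.var k ∈ (T.neighbor l).laurent := by
    induction h with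
    | refl => exact fun l => S.neighbor_var_mem none l k
    | tail hP hPQ ih =>
      obtain ⟨i, rfl⟩ := hPQ
      exact mem_neighbor_mutate (hS.mutationEquivalent hP) ih i
  exact hall none

end Seed

/-! ### Adjoining principal coefficients -/

namespace Seed

variable {K F : Type*} [CommRing K] [Field F] [Algebra K F] {n m : ℕ}

/-- The indices of the variables of a seed among those of a seed with `n` further frozen
variables. -/
def extendIndex : Fin n ⊕ Fin m → Fin n ⊕ Fin (m + n) :=
  Sum.map id (Fin.castAdd n)

/-- The specialization at `1` of `n` further frozen variables. -/
def extendVar (v : Fin n ⊕ Fin m → F) : Fin n ⊕ Fin (m + n) → F :=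
  Sum.elim (fun i => v (Sum.inl i)) (Fin.addCases (fun r => v (Sum.inr r)) fun _ => 1)

@[simp] theorem extendVar_extendIndex (v : Fin n ⊕ Fin m → F) (k : Fin n ⊕ Fin m) :
    extendVar v (extendIndex k) = v k := by
  cases k <;> simp [extendVar, extendIndex]

theorem extendIndex_eq_inl (k : Fin n ⊕ Fin m) (i : Fin n) :
    extendIndex k = Sum.inl i ↔ k = Sum.inl i := by
  cases k <;> simp [extendIndex]

/-- The exchange matrix with an identity matrix appended below. -/
def extendMatrix (B : Matrix (Fin n ⊕ Fin m) (Fin n) ℤ) :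
    Matrix (Fin n ⊕ Fin (m + n)) (Fin n) ℤ :=
  fun k j => Sum.elim (fun i => B (Sum.inl i) j)
    (Fin.addCases (fun r => B (Sum.inr r) j) fun l => if l = j then 1 else 0) k

theorem extendMatrix_extendIndex (B : Matrix (Fin n ⊕ Fin m) (Fin n) ℤ) (k : Fin n ⊕ Fin m)
    (j : Fin n) : extendMatrix B (extendIndex k) j = B k j := by
  cases k <;> simp [extendMatrix, extendIndex]

theorem prod_extendVar_pow (v : Fin n ⊕ Fin m → F) (e : Fin n ⊕ Fin (m + n) → ℕ) :
    ∏ k, extendVar v k ^ e k = ∏ k, v k ^ e (extendIndex k) := by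
  simp [Fintype.prod_sum_type, Fin.prod_univ_add, extendVar, extendIndex]

/-- A seed with principal coefficients: `n` frozen variables are added to a seed, and an identity
matrix to its exchange matrix. The ambient field is a fresh field of rational functions. -/
noncomputable def principalExtension [IsDomain K] (S : Seed K F n m) :
    Seed K (FractionRing (MvPolynomial (Fin n ⊕ Fin (m + n)) K)) n (m + n) where
  var k := algebraMap (MvPolynomial (Fin n ⊕ Fin (m + n)) K) _ (MvPolynomial.X k)
  B := extendMatrix S.B
  algebraicIndependent :=
    (MvPolynomial.algebraicIndependent_X (Fin n ⊕ Fin (m + n)) K).map'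
      (f := IsScalarTower.toAlgHom K _ _) (IsFractionRing.injective _ _)
  generates := by
    set E := Subfield.closure (Set.range (algebraMap K
      (FractionRing (MvPolynomial (Fin n ⊕ Fin (m + n)) K))) ∪ Set.range fun k =>
        algebraMap (MvPolynomial (Fin n ⊕ Fin (m + n)) K) (FractionRing _) (MvPolynomial.X k))
    have hmem : ∀ p : MvPolynomial (Fin n ⊕ Fin (m + n)) K,
        algebraMap _ (FractionRing _) p ∈ E := by
      intro p
      induction p using MvPolynomial.induction_on with
      | C a =>
        refine Subfield.subset_closure (Or.inl ⟨a, ?_⟩)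
        rw [IsScalarTower.algebraMap_apply K (MvPolynomial (Fin n ⊕ Fin (m + n)) K)]
        rfl
      | add p q hp hq => rw [map_add]; exact add_mem hp hq
      | mul_X p k hp => rw [map_mul]; exact mul_mem hp (Subfield.subset_closure (Or.inr ⟨k, rfl⟩))
    refine eq_top_iff.2 fun x _ => ?_
    obtain ⟨p, q, -, rfl⟩ := IsFractionRing.div_surjective
      (A := MvPolynomial (Fin n ⊕ Fin (m + n)) K) x
    exact div_mem (hmem p) (hmem q)
  skewSymmetrizable := S.skewSymmetrizable

theorem principalExtension_independentColumns [IsDomain K] (S : Seed K F n m) :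
    S.principalExtension.IndependentColumns := by
  intro v hv
  funext j
  simpa [principalExtension, extendMatrix] using hv (Sum.inr (Fin.natAdd m j))

variable [CharZero K]

/-- Setting the additional frozen variables to `1` commutes with mutation: a path of mutations from
`R` to `T`, followed from an extension `R'` of `R`, ends at an extension `T'` of `T`, and the
specialization of the Laurent polynomials in the variables of `T'` sends the variables of `R'` to
those of `R`. That the variables of `R'` are such Laurent polynomials is what allows this
homomorphism to be followed back along the path. -/
theorem exists_specialization {F' : Type*} [Field F'] [Algebra K F'] {R T : Seed K F n m}
    (h : R.MutationEquivalent T) (R' : Seed K F' n (m + n)) (hR' : R'.IndependentColumns)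
    (hB : ∀ k j, R'.B (extendIndex k) j = R.B k j) :
    ∃ T' : Seed K F' n (m + n), R'.MutationEquivalent T' ∧
      ∃ φ : T'.laurent →ₐ[K] T.laurent, ∀ k (hk : R'.var k ∈ T'.laurent),
        (φ ⟨R'.var k, hk⟩ : F) = extendVar R.var k := by
  induction h using Relation.ReflTransGen.head_induction_on generalizing R' with
  | refl =>
    let u : Fin n ⊕ Fin m → T.laurentˣ := fun k =>
      { val := ⟨_, T.var_mem_laurent k⟩
        inv := ⟨_, T.inv_var_mem_laurent k⟩
        val_inv := Subtype.ext (mul_inv_cancel₀ (T.var_ne_zero k))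
        inv_val := Subtype.ext (inv_mul_cancel₀ (T.var_ne_zero k)) }
    obtain ⟨φ, hφ⟩ := R'.exists_algHom_laurent (A := T.laurent) (Sum.elim (fun i => u (Sum.inl i))
      (Fin.addCases (fun r => u (Sum.inr r)) fun _ => 1))
    refine ⟨R', .refl, φ, fun k hk => ?_⟩
    rw [hφ]
    rcases k with i | r
    · rfl
    · induction r using Fin.addCases <;> simp [extendVar, u]
  | @head R R₁ hstep _ ih =>
    obtain ⟨i, rfl⟩ := hstep
    obtain ⟨T', hT', φ, hφ⟩ := ih (R'.mutate i) (hR'.mutate i) fun k j => by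
      simp only [mutate_B, mutateMatrix, extendIndex_eq_inl, hB]
      rw [show R'.B (Sum.inl i) j = R.B (Sum.inl i) j from hB (Sum.inl i) j]
    have hRT' : R'.MutationEquivalent T' := .head ⟨i, rfl⟩ hT'
    refine ⟨T', hRT', φ, ?_⟩
    have hmem : ∀ k, R'.var k ∈ T'.laurent := fun k => hR'.var_mem_laurent hRT' k
    have hmem' : ∀ k, R'.mutateVar i k ∈ T'.laurent := fun k =>
      (hR'.mutate i).var_mem_laurent hT' k
    have hne : ∀ k ≠ Sum.inl i, (φ ⟨R'.var k, hmem k⟩ : F) = extendVar R.var k := by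
      intro k hk
      have h1 := hφ k (hmem' k)
      have h2 : extendVar (R.mutate i).var k = extendVar R.var k := by
        rcases k with l | r
        · exact R.mutateVar_of_ne fun h => hk (by rw [Sum.inl_injective h])
        · induction r using Fin.addCases <;> simp [extendVar, mutateVar]
      rw [← h2, ← h1]
      congr 2
      exact Subtype.ext (R'.mutateVar_of_ne hk).symm
    intro k hk
    by_cases hki : k = Sum.inl i
    · subst hki
      -- Both exchange relations in direction `i` determine the remaining variable.
      have hmono : ∀ e : ℤ → ℕ, e 0 = 0 →
          ((φ (∏ k, ⟨R'.var k, hmem k⟩ ^ e (R'.B k i)) : T.laurent) : F) =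
            ∏ k, R.var k ^ e (R.B k i) := by
        intro e he
        simp only [← hB, ← prod_extendVar_pow R.var fun k => e (R'.B k i)]
        simp only [map_prod, map_pow, SubmonoidClass.coe_finsetProd, SubmonoidClass.coe_pow]
        refine Finset.prod_congr rfl fun k _ => ?_
        by_cases hk : k = Sum.inl i
        · rw [hk, B_diag, he, pow_zero, pow_zero]
        · rw [hne k hk]
      have hrel : (⟨R'.var (Sum.inl i), hk⟩ * ⟨R'.mutateVar i (Sum.inl i), hmem' _⟩ : T'.laurent) =
          ∏ k, ⟨R'.var k, hmem k⟩ ^ (R'.B k i).toNat +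
            ∏ k, ⟨R'.var k, hmem k⟩ ^ (-R'.B k i).toNat :=
        Subtype.ext (by simpa [exchange] using R'.var_mul_mutateVar i)
      have h1 := congrArg (fun x => ((φ x : T.laurent) : F)) hrel
      simp only [map_mul, map_add, MulMemClass.coe_mul, AddMemClass.coe_add,
        hmono Int.toNat rfl, hmono (fun a => (-a).toNat) rfl] at h1
      have h2 : (φ ⟨R'.mutateVar i (Sum.inl i), hmem' _⟩ : F) = R.mutateVar i (Sum.inl i) :=
        hφ (Sum.inl i) (hmem' _)
      rw [h2] at h1
      exact mul_right_cancel₀ (R.mutateVar_ne_zero i _) (h1.trans (R.var_mul_mutateVar i).symm)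
    · exact hne k hki

/-- The Laurent phenomenon. -/
theorem MutationEquivalent.var_mem_laurent {S T : Seed K F n m} (h : S.MutationEquivalent T)
    (k : Fin n ⊕ Fin m) : S.var k ∈ T.laurent := by
  have : IsDomain K := S.algebraicIndependent.algebraMap_injective.isDomain (algebraMap K F)
  have hind := S.principalExtension_independentColumns
  obtain ⟨T', hT', φ, hφ⟩ := exists_specialization h S.principalExtension hind
    fun k j => extendMatrix_extendIndex S.B k j
  have hk := hφ (extendIndex k) (hind.var_mem_laurent hT' _)
  rw [extendVar_extendIndex] at hk
  rw [← hk]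
  exact (φ _).2

end Seed

/-! ### Height-one primes of upper cluster algebras -/

theorem theorem3p5 {K F : Type*} [CommRing K] [CharZero K]
    (hK : IsField K ∨ Nonempty (K ≃+* ℤ)) [Field F] [Algebra K F] {n m : ℕ}
    (S : Seed K F n m) (hU : IsKrullDomain S.upperClusterAlgebra) :
    (∀ p ∈ heightOnePrimes S.upperClusterAlgebra,
      ∃ Z : Seed K F n m, S.MutationEquivalent Z ∧
        ∃ h : S.upperClusterAlgebra ≤ Z.laurent,
          p.map (Subalgebra.inclusion h) ∈ heightOnePrimes Z.laurent) ∧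
    (∀ Z : Seed K F n m, (∀ j : Fin m, Z.var (Sum.inr j) = S.var (Sum.inr j)) →
      S.upperClusterAlgebra = ⨅ k : Option (Fin n), (Z.neighbor k).laurent →
      ∀ p ∈ heightOnePrimes S.upperClusterAlgebra,
        ∃ k : Option (Fin n), ∃ h : S.upperClusterAlgebra ≤ (Z.neighbor k).laurent,
          p.map (Subalgebra.inclusion h) ∈ heightOnePrimes (Z.neighbor k).laurent) := by
  refine ⟨fun p hp => ?_, fun Z _ hZ p hp => ?_⟩
  · have hle : ∀ T : {T : Seed K F n m // S.MutationEquivalent T},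
        S.upperClusterAlgebra ≤ T.1.laurent := fun T => iInf₂_le T.1 T.2
    have hinter : ∀ x : F, (∀ T : {T : Seed K F n m // S.MutationEquivalent T},
        x ∈ T.1.laurent) → x ∈ S.upperClusterAlgebra := fun x hx => by
      simp only [Seed.upperClusterAlgebra, Algebra.mem_iInf]
      exact fun T hT => hx ⟨T, hT⟩
    have hvar : ∀ (T : {T : Seed K F n m // S.MutationEquivalent T}) k,
        T.1.var k ∈ S.upperClusterAlgebra := fun T k => hinter _ fun T' =>
      Seed.MutationEquivalent.var_mem_laurent (T.2.symm.trans T'.2) k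
    obtain ⟨T, hT⟩ := hU.exists_map_mem_heightOnePrimes (fun T => T.1.laurent)
      (fun T => ⟨_, prod_mem fun k _ => hvar T k⟩) hle (fun T => T.1.prod_var_ne_zero)
      (fun T => T.1.inv_prod_var_mem_laurent) (fun T => T.1.laurent_le_away _ (hvar T)) hinter hp
    exact ⟨T.1, T.2, hle T, hT⟩
  · have hle : ∀ k, S.upperClusterAlgebra ≤ (Z.neighbor k).laurent := fun k =>
      hZ.trans_le (iInf_le _ k)
    have hinter : ∀ x : F, (∀ k, x ∈ (Z.neighbor k).laurent) → x ∈ S.upperClusterAlgebra :=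
      fun x hx => by rw [hZ, Algebra.mem_iInf]; exact hx
    have hvar : ∀ k r, (Z.neighbor k).var r ∈ S.upperClusterAlgebra := fun k r =>
      hinter _ fun l => Z.neighbor_var_mem k l r
    obtain ⟨k, hk⟩ := hU.exists_map_mem_heightOnePrimes (fun k => (Z.neighbor k).laurent)
      (fun k => ⟨_, prod_mem fun r _ => hvar k r⟩) hle (fun k => (Z.neighbor k).prod_var_ne_zero)
      (fun k => (Z.neighbor k).inv_prod_var_mem_laurent)
      (fun k => (Z.neighbor k).laurent_le_away _ (hvar k)) hinter hp
    exact ⟨k, hle k, hk⟩
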